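/- Let $k,t,m\ge 0$ be integers. A two-layer network consists of a source $S$, $t$ relays and $m$ destinations $D_1,\dots,D_m$. There is an edge from $S$ to each relay, and an edge from relay $j$ to $D_i$ for each $j\in\mathcal M_i$, where $\mathcal M_i\subseteq[t]$. Each edge carries one symbol of a common finite field $\mathbb F_q$ per channel use. For $\mathcal A\subseteq[m]$ let $M_{\mathcal A}$ be the capacity of the min-cut between $S$ and $\{D_i: i\in\mathcal A\}$ (which equals $|\bigcup_{i\in\mathcal A}\mathcal M_i|$). A rate tuple $(R_1,\dots,R_m)$ is securely achievable if there are a block length $n\ge1$, a finite field $\mathbb F_q$, independent messages $W_1,\dots,W_m$ with $R_i=\frac1n H(W_i)$ (entropy in units of $\log q$), a source randomness $\Theta$ independent of the messages, and a code in which every edge leaving $S$ carries a function $X_e^n\in\mathbb F_q^n$ of $(W_{[m]},\Theta)$ and every other edge carries a function $X_e^n\in\mathbb F_q^n$ of what the edges entering its tail carry, such that $H(W_i\mid \{X_e^n: e\text{ enters }D_i\})=0$ for all $i$ and $I(W_{[m]};\{X_e^n: e\in\mathcal Z\})=0$ for every set $\mathcal Z$ of at most $k$ edges. The secure capacity region is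 the closure of the set of securely achievable tuples. The scheme. Let $\mathbb F_q$ be a finite field, $a_1,\dots,a_t\in\mathbb F_q$ distinct, and $V=(a_j^{l})_{1\le j\le t,\,0\le l<k}$ the $t\times k$ Vandermonde matrix. Let $N_i\subseteq\mathbb F_q^t$ be the null space of $\begin{bmatrix}V^T\\ C_i\end{bmatrix}$, where the rows of $C_i$ are the unit vectors $e_j$, $j\notin\mathcal M_i$. In one channel use, with $r_i$ independent uniform message packets $W_i\in\mathbb F_q^{r_i}$ for each $D_i$ and $k$ independent uniform random packets $K\in\mathbb F_q^k$, the source sends $X=GW+VK$ to the relays ($X_j$ to relay $j$), each relay forwards its symbol to all its destinations, and $D_i$ decodes with $r_i$ decoding vectors in $N_i$; here the matrix $G$ and the matrix $T$, whose rows are all the decoding vectors, satisfy $TG=I$. The scheme may be used with different $(r,G,T)$ in different channel uses (time sharing). The region it achieves is the closure of the set of the rate tuples of those of its codes that are zero-error decodable and perfectly secure against any $k$ wiretapped edges as above. Lemma. Suppose that $|\mathcal M_i|\ge k$ for all $i$, and that $|\mathcal M_i\cap\mathcal M_j|\ge k$ for all $i\ne j$. Then the secure capacity region of the two-layer network is $$\Big\{R\in\mathbb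 R^m:\ R_i\ge0\ \ \forall i\in[m],\ \ \sum_{i\in\mathcal A}R_i\le M_{\mathcal A}-k\ \ \forall\,\emptyset\ne\mathcal A\subseteq[m]\Big\},$$ and, for every finite field $\mathbb F_q$ and all distinct $a_1,\dots,a_t\in\mathbb F_q$, the region achieved by the scheme is equal to the secure capacity region. -/

import Mathlib

open scoped Matrix MeasureTheory

noncomputable section

/-! ### Shannon entropy of finitely valued random variables -/

/-- Shannon entropy `H(X)` (in nats) of a random variable with finitely many values. -/
def entropy {Ω α : Type*} [MeasurableSpace Ω] [Fintype α]
    (μ : MeasureTheory.Measure Ω) (X : Ω → α) : ℝ :=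
  ∑ x, Real.negMulLog (μ.real (X ⁻¹' {x}))

/-- Conditional entropy `H(X | Y) = H(X, Y) - H(Y)`. -/
def condEntropy {Ω α β : Type*} [MeasurableSpace Ω] [Fintype α] [Fintype β]
    (μ : MeasureTheory.Measure Ω) (X : Ω → α) (Y : Ω → β) : ℝ :=
  entropy μ (fun ω => (X ω, Y ω)) - entropy μ Y

/-- Mutual information `I(X ; Y) = H(X) - H(X | Y)`. -/
def mutualInfo {Ω α β : Type*} [MeasurableSpace Ω] [Fintype α] [Fintype β]
    (μ : MeasureTheory.Measure Ω) (X : Ω → α) (Y : Ω → β) : ℝ :=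
  entropy μ X - condEntropy μ X Y

/-! ### Two-layer networks -/

/-- A two-layer network with `t` relays and `m` destinations; `M i` is the set of the relays
that are connected to destination `i`. -/
structure TwoLayerNetwork (t m : ℕ) where
  M : Fin m → Finset (Fin t)

namespace TwoLayerNetwork

variable {t m : ℕ}

/-- The nodes: the source, the relays and the destinations. -/
inductive Node (t m : ℕ) where
  | source : Node t m
  | relay : Fin t → Node t m
  | dest : Fin m → Node t m
deriving DecidableEq

/-- The edges: `Sum.inl j` goes from the source to relay `j`, and `Sum.inr ⟨i, j⟩` goes
from relay `j ∈ M i` to destination `i`. -/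
abbrev Edge (N : TwoLayerNetwork t m) : Type :=
  Fin t ⊕ (Σ i : Fin m, {j : Fin t // j ∈ N.M i})

/-- The node that an edge leaves. -/
def tail (N : TwoLayerNetwork t m) : N.Edge → Node t m
  | Sum.inl _ => Node.source
  | Sum.inr e => Node.relay e.2.1

/-- The node that an edge enters. -/
def head (N : TwoLayerNetwork t m) : N.Edge → Node t m
  | Sum.inl j => Node.relay j
  | Sum.inr e => Node.dest e.1

/-- The incoming edges of a node. -/
abbrev InEdge (N : TwoLayerNetwork t m) (v : Node t m) : Type :=
  {e : N.Edge // N.head e = v}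

/-- The capacity of the minimum cut between the source and the destinations in `A`: the least
number of (unit capacity) edges that leave a set of nodes `U` which contains the source and
no destination of `A`. -/
def minCut (N : TwoLayerNetwork t m) (A : Finset (Fin m)) : ℕ :=
  sInf {c : ℕ | ∃ U : Set (Node t m), Node.source ∈ U ∧ (∀ i ∈ A, Node.dest i ∉ U) ∧
    c = Set.ncard {e : N.Edge | N.tail e ∈ U ∧ N.head e ∉ U}}

/-! ### Secure codes and the secure capacity region -/

/-- A zero-error code of block length `n` over the finite field `F` that is perfectly secure
against an eavesdropper who observes any `k` edges. `W i` is the message for destination `i`,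
`Θ` is the randomness of the source, and `X e` is what edge `e` carries in `n` channel uses. -/
structure IsSecureCode (N : TwoLayerNetwork t m) (k n : ℕ) (F : Type*) [Field F] [Fintype F]
    {Ω : Type*} [MeasurableSpace Ω] (μ : MeasureTheory.Measure Ω)
    {𝒲 : Fin m → Type*} [∀ i, Fintype (𝒲 i)] {S : Type*} [MeasurableSpace S]
    (W : (i : Fin m) → Ω → 𝒲 i) (Θ : Ω → S) (X : N.Edge → Ω → (Fin n → F)) : Prop where
  isProbabilityMeasure : MeasureTheory.IsProbabilityMeasure μ
  measurable_message : ∀ i, Measurable[_, ⊤] (W i)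
  measurable_randomness : Measurable Θ
  /-- The messages are independent. -/
  indep_messages : ProbabilityTheory.iIndepFun (m := fun _ => ⊤) W μ
  /-- The randomness of the source is independent of the messages. -/
  indep_randomness :
    @ProbabilityTheory.IndepFun Ω ((i : Fin m) → 𝒲 i) S _ ⊤ _ (fun ω i => W i ω) Θ μ
  /-- The source encodes all the messages with its randomness. -/
  source_encoding : ∀ e, N.tail e = Node.source →
    ∃ f : ((i : Fin m) → 𝒲 i) → S → (Fin n → F),
      (∀ w, Measurable[_, ⊤] (f w)) ∧ ∀ ω, X e ω = f (fun i => W i ω) (Θ ω)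
  /-- Every other node encodes what it receives, without randomness of its own. -/
  relay_encoding : ∀ e, N.tail e ≠ Node.source →
    ∃ f : (N.InEdge (N.tail e) → (Fin n → F)) → (Fin n → F),
      ∀ ω, X e ω = f (fun l => X l.1 ω)
  /-- Zero-error decoding. -/
  decoding : ∀ i, condEntropy μ (W i)
    (fun ω (e : N.InEdge (Node.dest i)) => X e.1 ω) = 0
  /-- Perfect secrecy. -/
  secrecy : ∀ Z : Finset N.Edge, Z.card ≤ k →
    mutualInfo μ (fun ω (i : Fin m) => W i ω) (fun ω (e : Z) => X e.1 ω) = 0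

/-- The rate `H(W) / n` of a message, in symbols of the alphabet `F` per channel use. -/
def rate (n : ℕ) (F : Type*) [Fintype F] {Ω α : Type*} [MeasurableSpace Ω] [Fintype α]
    (μ : MeasureTheory.Measure Ω) (W : Ω → α) : ℝ :=
  entropy μ W / Real.log (Fintype.card F) / n

/-- A rate tuple that some secure code, over some finite field, attains. -/
def IsSecurelyAchievable (N : TwoLayerNetwork t m) (k : ℕ) (R : Fin m → ℝ) : Prop :=
  ∃ (n : ℕ) (F : Type) (_ : Field F) (_ : Fintype F)
    (Ω : Type) (_ : MeasurableSpace Ω) (μ : MeasureTheory.Measure Ω)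
    (𝒲 : Fin m → Type) (_ : ∀ i, Fintype (𝒲 i)) (S : Type) (_ : MeasurableSpace S)
    (W : (i : Fin m) → Ω → 𝒲 i) (Θ : Ω → S) (X : N.Edge → Ω → (Fin n → F)),
    0 < n ∧ N.IsSecureCode k n F μ W Θ X ∧ ∀ i, R i = rate n F μ (W i)

/-- The secure capacity region: the closure of the set of securely achievable rate tuples. -/
def secureCapacityRegion (N : TwoLayerNetwork t m) (k : ℕ) : Set (Fin m → ℝ) :=
  closure {R | N.IsSecurelyAchievable k R}

/-! ### The Vandermonde scheme -/

/-- The `t × k` Vandermonde matrix `V` with evaluation points `a`. -/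
def vandermondeMatrix {F : Type*} [Field F] (k : ℕ) (a : Fin t → F) :
    Matrix (Fin t) (Fin k) F :=
  Matrix.of fun j l => a j ^ (l : ℕ)

/-- The matrix `C i`: one row for each relay that destination `i` is not connected to, with a
single one, at the position of that relay. -/
def unconnectedMatrix (N : TwoLayerNetwork t m) (F : Type*) [Field F] (i : Fin m) :
    Matrix {j : Fin t // j ∉ N.M i} (Fin t) F :=
  Matrix.of fun j l => if l = j.1 then 1 else 0

/-- The space of the decoding vectors of destination `i`: the right null space of the matrix
`V i` that has the rows of `Vᵀ` on top of those of `C i`. -/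
def decodingSpace (N : TwoLayerNetwork t m) {F : Type*} [Field F] (k : ℕ) (a : Fin t → F)
    (i : Fin m) : Submodule F (Fin t → F) :=
  LinearMap.ker
    (Matrix.fromRows (vandermondeMatrix k a)ᵀ (N.unconnectedMatrix F i)).mulVecLin

/-- The `k` random packets of each of the `n` channel uses. -/
def SchemeKey (F : Type*) (k n : ℕ) : Type _ :=
  Fin n → Fin k → F

instance (F : Type*) (k n : ℕ) : MeasurableSpace (SchemeKey F k n) := ⊤

/-- The sample space of the scheme in `n` channel uses: in channel use `s`, there are
`r s i` message packets for destination `i`, and `k` random packets. -/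
def SchemeSpace (F : Type*) (k n : ℕ) (r : Fin n → Fin m → ℕ) : Type _ :=
  ((s : Fin n) → (i : Fin m) → Fin (r s i) → F) × SchemeKey F k n

instance (F : Type*) (k n : ℕ) (r : Fin n → Fin m → ℕ) :
    MeasurableSpace (SchemeSpace F k n r) := ⊤

/-- All the packets are independent and uniformly distributed. -/
def schemeMeasure (F : Type*) (k n : ℕ) (r : Fin n → Fin m → ℕ) :
    MeasureTheory.Measure (SchemeSpace F k n r) :=
  ProbabilityTheory.uniformOn Set.univ

/-- The message for destination `i`: its packets in all the channel uses. -/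
def schemeMessage {F : Type*} {k n : ℕ} {r : Fin n → Fin m → ℕ} (i : Fin m)
    (ω : SchemeSpace F k n r) : (s : Fin n) → Fin (r s i) → F :=
  fun s => ω.1 s i

/-- The random packets. -/
def schemeKey {F : Type*} {k n : ℕ} {r : Fin n → Fin m → ℕ}
    (ω : SchemeSpace F k n r) : SchemeKey F k n :=
  ω.2

/-- The symbols `[M | V] [W ; K]` that the source sends to the relays in channel use `s`. -/
def relaySymbols {F : Type*} [Field F] {k n : ℕ} {r : Fin n → Fin m → ℕ} (a : Fin t → F)
    (G : (s : Fin n) → Matrix (Fin t) (Σ i : Fin m, Fin (r s i)) F)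
    (ω : SchemeSpace F k n r) (s : Fin n) : Fin t → F :=
  G s *ᵥ (fun p => ω.1 s p.1 p.2) + vandermondeMatrix k a *ᵥ ω.2 s

/-- What the edges carry: every relay forwards its symbol to its destinations. -/
def schemeTransmission (N : TwoLayerNetwork t m) {F : Type*} [Field F] {k n : ℕ}
    {r : Fin n → Fin m → ℕ} (a : Fin t → F)
    (G : (s : Fin n) → Matrix (Fin t) (Σ i : Fin m, Fin (r s i)) F) :
    N.Edge → SchemeSpace F k n r → (Fin n → F)
  | Sum.inl j, ω => fun s => relaySymbols a G ω s j
  | Sum.inr e, ω => fun s => relaySymbols a G ω s e.2.1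

/-- A rate tuple that the scheme with evaluation points `a` attains. In each of the `n` channel
uses `s`, the scheme is used with an encoding matrix `G s` for the message packets and with
decoding vectors (the rows of `T s`) such that `T s * G s = 1`, where those of destination `i`
belong to its decoding space. The scheme so obtained has to be a secure code. -/
def IsSchemeAchievable (N : TwoLayerNetwork t m) (k : ℕ) (F : Type*) [Field F] [Fintype F]
    (a : Fin t → F) (R : Fin m → ℝ) : Prop :=
  ∃ (n : ℕ) (r : Fin n → Fin m → ℕ)
    (G : (s : Fin n) → Matrix (Fin t) (Σ i : Fin m, Fin (r s i)) F)
    (T : (s : Fin n) → Matrix (Σ i : Fin m, Fin (r s i)) (Fin t) F),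
    0 < n ∧
    (∀ s p, T s p ∈ N.decodingSpace k a p.1) ∧
    (∀ s, T s * G s = 1) ∧
    N.IsSecureCode k n F (schemeMeasure F k n r) schemeMessage schemeKey
      (N.schemeTransmission a G) ∧
    ∀ i, R i = rate n F (schemeMeasure F k n r) (schemeMessage i)

/-- The rate region that the scheme with evaluation points `a` achieves. -/
def schemeRegion (N : TwoLayerNetwork t m) (k : ℕ) (F : Type*) [Field F] [Fintype F]
    (a : Fin t → F) : Set (Fin m → ℝ) :=
  closure {R | N.IsSchemeAchievable k F a R}

end TwoLayerNetwork

end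

/-! Write `U` for the set of relays that serve some destination in `A`; the min-cut of `A` is
`U.card`. Three regions are sandwiched: the secure capacity region lies in the polytope, the
polytope in the scheme region, and the scheme region in the secure capacity region.

Converse (`IsSecureCode.sum_entropy_le`). Let the eavesdropper see `k` relays `Z ⊆ U`, with symbols
`Y`. Secrecy and independence of the messages give `∑_A H(W i) + H(Y) ≤ H(W_A, Y)`. The symbols on
`U` determine `Y` and everything that `A` receives, so the right side is at most `H(X_U) ≤ H(Y) +
H(X_{U \ Z})`. Cancelling `H(Y)` leaves the at most `n` field symbols of each of the `U.card - k`
unseen relays.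

Achievability. The decoding space of `i` consists of the vectors supported on `N.M i` that
annihilate the Vandermonde columns. If any two of the `N.M i` share `k` relays, the decoding spaces
of `A` together span the corresponding space for `U` (`supportedKernel_biUnion_le`), whose dimension
is at least `U.card - k`. Thus the rate inequalities are exactly what Rado's theorem
(`exists_linearIndependent_transversal`) needs in order to pick independent decoding vectors, over
any finite field. Independence gives `G` with `T * G = 1`, and decoding cancels the random packets
because `T * V = 0`. Secrecy is a one-time pad: any `k` rows of the Vandermonde matrix are
independent, so a change of the random packets can mask any pattern on `k` relays
(`mutualInfo_schemeTransmission`). Integer packet counts over many channel uses approximate every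
real rate tuple. -/

noncomputable section

/-! ### Entropy of finitely valued random variables -/

section Entropy

open MeasureTheory

variable {Ω α β γ δ : Type*} [MeasurableSpace Ω]

/-- All the fibers of `X` are measurable. -/
def HasMeasurableFibers (X : Ω → α) : Prop := ∀ x, MeasurableSet (X ⁻¹' {x})

theorem HasMeasurableFibers.preimage [Finite α] {X : Ω → α} (hX : HasMeasurableFibers X)
    (s : Set α) : MeasurableSet (X ⁻¹' s) := by
  rw [← Set.biUnion_preimage_singleton]
  exact s.toFinite.measurableSet_biUnion fun x _ => hX x

theorem HasMeasurableFibers.of_factorsThrough [Finite α] {X : Ω → α} {Y : Ω → β}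
    (hX : HasMeasurableFibers X) (h : Y.FactorsThrough X) : HasMeasurableFibers Y := by
  intro y
  have : Y ⁻¹' {y} = X ⁻¹' (X '' (Y ⁻¹' {y})) := by
    ext ω
    constructor
    · exact fun hω => ⟨ω, hω, rfl⟩
    · rintro ⟨ω', h', e⟩
      exact (h e).symm.trans h'
  rw [this]
  exact hX.preimage _

theorem HasMeasurableFibers.prodMk {X : Ω → α} {Y : Ω → β}
    (hX : HasMeasurableFibers X) (hY : HasMeasurableFibers Y) :
    HasMeasurableFibers fun ω => (X ω, Y ω) := by
  rintro ⟨x, y⟩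
  convert (hX x).inter (hY y) using 1
  ext ω
  simp

theorem HasMeasurableFibers.pi {ι : Type*} [Finite ι] {α : ι → Type*} {X : (i : ι) → Ω → α i}
    (hX : ∀ i, HasMeasurableFibers (X i)) : HasMeasurableFibers fun ω i => X i ω := by
  intro x
  convert MeasurableSet.iInter fun i => hX i (x i) using 1
  ext ω
  simp [funext_iff]

variable [Fintype α] [Fintype β] [Fintype γ] [Fintype δ] {μ : Measure Ω}

theorem entropy_nonneg [IsProbabilityMeasure μ] (X : Ω → α) : 0 ≤ entropy μ X :=
  Finset.sum_nonneg fun _ _ => Real.negMulLog_nonneg measureReal_nonneg measureReal_le_one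

/-- By monotonicity of `log`, each term only loses when `log (p i)` is replaced by the log of the
sum. This is why merging values cannot increase entropy. -/
theorem negMulLog_sum_le {ι : Type*} (s : Finset ι) {p : ι → ℝ} (hp : ∀ i ∈ s, 0 ≤ p i) :
    Real.negMulLog (∑ i ∈ s, p i) ≤ ∑ i ∈ s, Real.negMulLog (p i) := by
  have h : Real.negMulLog (∑ i ∈ s, p i) = ∑ i ∈ s, -(p i * Real.log (∑ j ∈ s, p j)) := by
    rw [Real.negMulLog, Finset.sum_neg_distrib, ← Finset.sum_mul, neg_mul]
  rw [h]
  refine Finset.sum_le_sum fun i hi => ?_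
  rcases (hp i hi).eq_or_lt with h0 | h0
  · simp [← h0]
  · have := Real.log_le_log h0 (Finset.single_le_sum hp hi)
    rw [Real.negMulLog]
    nlinarith

theorem measureReal_preimage_eq_sum [IsFiniteMeasure μ] {X : Ω → α} (hX : HasMeasurableFibers X)
    (s : Set α) [DecidablePred (· ∈ s)] :
    μ.real (X ⁻¹' s) = ∑ x with x ∈ s, μ.real (X ⁻¹' {x}) := by
  rw [sum_measureReal_preimage_singleton _ fun x _ => hX x]
  simp

theorem sum_measureReal_fibers [IsProbabilityMeasure μ] {X : Ω → α}
    (hX : HasMeasurableFibers X) : ∑ x, μ.real (X ⁻¹' {x}) = 1 := by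
  classical
  have := measureReal_preimage_eq_sum (μ := μ) hX Set.univ
  simpa using this.symm

theorem entropy_le_of_factorsThrough [IsProbabilityMeasure μ] {X : Ω → α} {Y : Ω → β}
    (hX : HasMeasurableFibers X) (h : Y.FactorsThrough X) : entropy μ Y ≤ entropy μ X := by
  classical
  have : Nonempty Ω := nonempty_of_isProbabilityMeasure μ
  have : Nonempty β := this.map Y
  obtain ⟨f, rfl⟩ := (Function.factorsThrough_iff Y).1 h
  calc entropy μ (f ∘ X)
      = ∑ y, Real.negMulLog (∑ x with f x = y, μ.real (X ⁻¹' {x})) := by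
        refine Finset.sum_congr rfl fun y _ => ?_
        rw [Set.preimage_comp, measureReal_preimage_eq_sum hX]
        simp
    _ ≤ ∑ y, ∑ x with f x = y, Real.negMulLog (μ.real (X ⁻¹' {x})) :=
        Finset.sum_le_sum fun y _ => negMulLog_sum_le _ fun _ _ => measureReal_nonneg
    _ = entropy μ X := Finset.sum_fiberwise _ _ _

theorem entropy_congr_of_factorsThrough [IsProbabilityMeasure μ] {X : Ω → α} {Y : Ω → β}
    (hX : HasMeasurableFibers X) (h : Y.FactorsThrough X) (h' : X.FactorsThrough Y) :
    entropy μ Y = entropy μ X :=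
  (entropy_le_of_factorsThrough hX h).antisymm
    (entropy_le_of_factorsThrough (hX.of_factorsThrough h) h')

/-- Nonnegativity of mutual information, from `log x ≤ x - 1` at `x = u v / (P p)`. The total mass
`P` is left arbitrary so that the inequality applies to each slice `Z = z` of a joint law. -/
theorem negMulLog_add_negMulLog_sum_le {p : α → β → ℝ} (hp : ∀ x y, 0 ≤ p x y) :
    ∑ x, ∑ y, Real.negMulLog (p x y) + Real.negMulLog (∑ x, ∑ y, p x y) ≤
      ∑ x, Real.negMulLog (∑ y, p x y) + ∑ y, Real.negMulLog (∑ x, p x y) := by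
  set P := ∑ x, ∑ y, p x y with hP
  set u : α → ℝ := fun x => ∑ y, p x y with hu
  set v : β → ℝ := fun y => ∑ x, p x y with hv
  have hP0 : 0 ≤ P := Finset.sum_nonneg fun x _ => Finset.sum_nonneg fun y _ => hp x y
  have hu0 : ∀ x, 0 ≤ u x := fun x => Finset.sum_nonneg fun y _ => hp x y
  have hv0 : ∀ y, 0 ≤ v y := fun y => Finset.sum_nonneg fun x _ => hp x y
  have hvP : ∑ y, v y = P := Finset.sum_comm
  have key : ∀ x y, p x y - u x * v y / P ≤
      p x y * (Real.log (p x y) + Real.log P - Real.log (u x) - Real.log (v y)) := by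
    intro x y
    rcases (hp x y).eq_or_lt with h0 | h0
    · rw [← h0]
      have := div_nonneg (mul_nonneg (hu0 x) (hv0 y)) hP0
      simpa using this
    · have hux : 0 < u x :=
        h0.trans_le (Finset.single_le_sum (fun y _ => hp x y) (Finset.mem_univ y))
      have hvy : 0 < v y :=
        h0.trans_le (Finset.single_le_sum (f := fun x => p x y) (fun x _ => hp x y)
          (Finset.mem_univ x))
      have hPp : 0 < P := hux.trans_le (Finset.single_le_sum (fun x _ => hu0 x) (Finset.mem_univ x))
      have h1 := Real.log_le_sub_one_of_pos (x := u x * v y / (P * p x y)) (by positivity)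
      rw [Real.log_div (by positivity) (by positivity), Real.log_mul hux.ne' hvy.ne',
        Real.log_mul hPp.ne' h0.ne'] at h1
      have h2 : p x y * (u x * v y / (P * p x y)) = u x * v y / P := by
        field_simp
      nlinarith
  have hsum : ∑ x, ∑ y, (p x y - u x * v y / P) = 0 := by
    have : ∑ x, ∑ y, u x * v y / P = P := by
      calc ∑ x, ∑ y, u x * v y / P = P * P / P := by
            simp_rw [← Finset.sum_div, ← Finset.mul_sum, hvP, ← Finset.sum_mul]
            rfl
        _ = P := mul_self_div_self P
    simp_rw [Finset.sum_sub_distrib]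
    rw [this, sub_self]
  have hle := Finset.sum_le_sum fun x (_ : x ∈ Finset.univ) =>
    Finset.sum_le_sum fun y (_ : y ∈ Finset.univ) => key x y
  rw [hsum] at hle
  have e1 : Real.negMulLog P = -∑ x, ∑ y, p x y * Real.log P := by
    simp_rw [← Finset.sum_mul]
    rw [Real.negMulLog, neg_mul]
  have e2 : ∑ x, Real.negMulLog (u x) = -∑ x, ∑ y, p x y * Real.log (u x) := by
    simp_rw [← Finset.sum_mul, Real.negMulLog, neg_mul, Finset.sum_neg_distrib]
    rfl
  have e3 : ∑ y, Real.negMulLog (v y) = -∑ x, ∑ y, p x y * Real.log (v y) := by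
    rw [Finset.sum_comm]
    simp_rw [← Finset.sum_mul, Real.negMulLog, neg_mul, Finset.sum_neg_distrib]
    rfl
  have e4 : ∑ x, ∑ y, Real.negMulLog (p x y) = -∑ x, ∑ y, p x y * Real.log (p x y) := by
    simp_rw [Real.negMulLog, neg_mul, Finset.sum_neg_distrib]
  rw [e1, e2, e3, e4]
  simp_rw [mul_sub, mul_add, Finset.sum_sub_distrib, Finset.sum_add_distrib] at hle
  linarith

theorem entropy_submodular_prod [IsProbabilityMeasure μ] {X : Ω → α} {Y : Ω → β} {Z : Ω → γ}
    (hX : HasMeasurableFibers X) (hY : HasMeasurableFibers Y) (hZ : HasMeasurableFibers Z) :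
    entropy μ (fun ω => (Z ω, X ω, Y ω)) + entropy μ Z ≤
      entropy μ (fun ω => (Z ω, X ω)) + entropy μ (fun ω => (Z ω, Y ω)) := by
  classical
  set p : γ → α → β → ℝ := fun z x y => μ.real ((fun ω => (Z ω, X ω, Y ω)) ⁻¹' {(z, x, y)})
  have hm := hZ.prodMk (hX.prodMk hY)
  have e1 : ∀ z, μ.real (Z ⁻¹' {z}) = ∑ x, ∑ y, p z x y := by
    intro z
    have : Z ⁻¹' {z} = (fun ω => (Z ω, X ω, Y ω)) ⁻¹'
        (({z} ×ˢ Finset.univ : Finset (γ × α × β)) : Set (γ × α × β)) := by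
      ext; simp [eq_comm]
    rw [this, ← sum_measureReal_preimage_singleton _ fun x _ => hm x]
    rw [Finset.sum_product, Finset.sum_singleton, Fintype.sum_prod_type]
  have e2 : ∀ z x, μ.real ((fun ω => (Z ω, X ω)) ⁻¹' {(z, x)}) = ∑ y, p z x y := by
    intro z x
    have : (fun ω => (Z ω, X ω)) ⁻¹' {(z, x)} = (fun ω => (Z ω, X ω, Y ω)) ⁻¹'
        (({z} ×ˢ {x} ×ˢ Finset.univ : Finset (γ × α × β)) : Set (γ × α × β)) := by
      ext; simp [eq_comm, and_comm]
    rw [this, ← sum_measureReal_preimage_singleton _ fun x _ => hm x]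
    rw [Finset.sum_product, Finset.sum_singleton, Finset.sum_product, Finset.sum_singleton]
  have e3 : ∀ z y, μ.real ((fun ω => (Z ω, Y ω)) ⁻¹' {(z, y)}) = ∑ x, p z x y := by
    intro z y
    have : (fun ω => (Z ω, Y ω)) ⁻¹' {(z, y)} = (fun ω => (Z ω, X ω, Y ω)) ⁻¹'
        (({z} ×ˢ Finset.univ ×ˢ {y} : Finset (γ × α × β)) : Set (γ × α × β)) := by
      ext; simp [eq_comm, and_comm]
    rw [this, ← sum_measureReal_preimage_singleton _ fun x _ => hm x]
    rw [Finset.sum_product, Finset.sum_singleton, Finset.sum_product]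
    simp only [Finset.sum_singleton]
    rfl
  simp only [entropy, Fintype.sum_prod_type, e1, e2, e3]
  rw [← Finset.sum_add_distrib, ← Finset.sum_add_distrib]
  exact Finset.sum_le_sum fun z _ => negMulLog_add_negMulLog_sum_le fun x y => measureReal_nonneg

/-- Submodularity of the entropy, for variables `Z` that both of `X` and `Y` determine and `T`
that `X` and `Y` together determine. -/
theorem entropy_submodular [IsProbabilityMeasure μ] {X : Ω → α} {Y : Ω → β} {Z : Ω → γ}
    {T : Ω → δ} (hX : HasMeasurableFibers X) (hY : HasMeasurableFibers Y)
    (hZX : Z.FactorsThrough X) (hZY : Z.FactorsThrough Y)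
    (hT : T.FactorsThrough fun ω => (X ω, Y ω)) :
    entropy μ T + entropy μ Z ≤ entropy μ X + entropy μ Y := by
  have hZ := hX.of_factorsThrough hZX
  have h := entropy_submodular_prod (μ := μ) hX hY hZ
  have h1 : entropy μ T ≤ entropy μ (fun ω => (Z ω, X ω, Y ω)) :=
    entropy_le_of_factorsThrough (hZ.prodMk (hX.prodMk hY)) fun a b hab => hT (congrArg Prod.snd hab)
  have h2 : entropy μ (fun ω => (Z ω, X ω)) ≤ entropy μ X :=
    entropy_le_of_factorsThrough hX fun a b hab => Prod.ext (hZX hab) hab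
  have h3 : entropy μ (fun ω => (Z ω, Y ω)) ≤ entropy μ Y :=
    entropy_le_of_factorsThrough hY fun a b hab => Prod.ext (hZY hab) hab
  linarith

theorem entropy_le_add [IsProbabilityMeasure μ] {X : Ω → α} {Y : Ω → β} {T : Ω → δ}
    (hX : HasMeasurableFibers X) (hY : HasMeasurableFibers Y)
    (hT : T.FactorsThrough fun ω => (X ω, Y ω)) :
    entropy μ T ≤ entropy μ X + entropy μ Y := by
  have h := entropy_submodular (μ := μ) (Z := fun _ => ()) hX hY (fun _ _ _ => rfl)
    (fun _ _ _ => rfl) hT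
  have := entropy_nonneg (μ := μ) (fun _ : Ω => ())
  linarith

/-- Gibbs' inequality against the uniform law: the correction terms `1 / card α - p` in `key` sum to
zero. -/
theorem entropy_le_log_card [IsProbabilityMeasure μ] {X : Ω → α} (hX : HasMeasurableFibers X) :
    entropy μ X ≤ Real.log (Fintype.card α) := by
  have : Nonempty Ω := nonempty_of_isProbabilityMeasure μ
  have : Nonempty α := this.map X
  have hN : (0 : ℝ) < Fintype.card α := by exact_mod_cast Fintype.card_pos
  have key : ∀ x, Real.negMulLog (μ.real (X ⁻¹' {x})) ≤
      μ.real (X ⁻¹' {x}) * Real.log (Fintype.card α) +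
        ((Fintype.card α : ℝ)⁻¹ - μ.real (X ⁻¹' {x})) := by
    intro x
    rcases (measureReal_nonneg (μ := μ) (s := X ⁻¹' {x})).eq_or_lt with h0 | h0
    · rw [← h0]; simp
    · set p := μ.real (X ⁻¹' {x})
      have h1 := Real.log_le_sub_one_of_pos (x := (p * Fintype.card α)⁻¹) (by positivity)
      rw [Real.log_inv, Real.log_mul h0.ne' hN.ne'] at h1
      have h2 : p * (p * (Fintype.card α : ℝ))⁻¹ = (Fintype.card α : ℝ)⁻¹ := by field_simp
      rw [Real.negMulLog]
      nlinarith
  refine (Finset.sum_le_sum fun x _ => key x).trans ?_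
  rw [Finset.sum_add_distrib, Finset.sum_sub_distrib, ← Finset.sum_mul, sum_measureReal_fibers hX]
  simp [hN.ne']

theorem entropy_prod_of_indep [IsProbabilityMeasure μ] {X : Ω → α} {Y : Ω → β}
    (hX : HasMeasurableFibers X) (hY : HasMeasurableFibers Y)
    (h : ∀ x y, μ.real (X ⁻¹' {x} ∩ Y ⁻¹' {y}) = μ.real (X ⁻¹' {x}) * μ.real (Y ⁻¹' {y})) :
    entropy μ (fun ω => (X ω, Y ω)) = entropy μ X + entropy μ Y := by
  have e : ∀ x y, (fun ω => (X ω, Y ω)) ⁻¹' {(x, y)} = X ⁻¹' {x} ∩ Y ⁻¹' {y} := by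
    intro x y; ext; simp
  simp only [entropy, Fintype.sum_prod_type, e, h, Real.negMulLog_mul, Finset.sum_add_distrib,
    ← Finset.mul_sum, ← Finset.sum_mul, sum_measureReal_fibers hX, sum_measureReal_fibers hY, one_mul]

theorem entropy_pi_of_indep [IsProbabilityMeasure μ] {ι : Type*} [Fintype ι] [DecidableEq ι]
    {α : ι → Type*} [∀ i, Fintype (α i)] {X : (i : ι) → Ω → α i}
    (hX : ∀ i, HasMeasurableFibers (X i))
    (h : ∀ x : (i : ι) → α i, μ.real (⋂ i, X i ⁻¹' {x i}) = ∏ i, μ.real (X i ⁻¹' {x i})) :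
    entropy μ (fun ω i => X i ω) = ∑ i, entropy μ (X i) := by
  have e : ∀ x, (fun ω i => X i ω) ⁻¹' {x} = ⋂ i, X i ⁻¹' {x i} := by
    intro x; ext; simp [funext_iff]
  set q : (i : ι) → α i → ℝ := fun i a => μ.real (X i ⁻¹' {a}) with hq
  -- Leibniz rule for `negMulLog`. Every summand is a product over coordinates, so its sum over `x`
  -- factors, and all factors but the `i`-th are total masses equal to one.
  have key : ∀ x : (i : ι) → α i, Real.negMulLog (∏ i, q i (x i)) =
      ∑ i, ∏ j, if j = i then Real.negMulLog (q j (x j)) else q j (x j) := by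
    intro x
    have h1 : ∀ i, (∏ j, if j = i then Real.negMulLog (q j (x j)) else q j (x j)) =
        -((∏ j, q j (x j)) * Real.log (q i (x i))) := by
      intro i
      rw [← Finset.mul_prod_erase _ _ (Finset.mem_univ i),
        ← Finset.mul_prod_erase _ (fun j => q j (x j)) (Finset.mem_univ i), if_pos rfl,
        Finset.prod_congr rfl (g := fun j => q j (x j))
          fun j hj => if_neg (Finset.ne_of_mem_erase hj), Real.negMulLog]
      ring
    simp_rw [h1, Finset.sum_neg_distrib, ← Finset.mul_sum, Real.negMulLog, neg_mul]
    by_cases h0 : ∏ j, q j (x j) = 0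
    · simp [h0]
    · rw [Real.log_prod fun i hi => (Finset.prod_ne_zero_iff.1 h0 i hi)]
  simp only [entropy, e, h]
  rw [Finset.sum_congr rfl fun x _ => key x, Finset.sum_comm]
  refine Finset.sum_congr rfl fun i _ => ?_
  rw [← Fintype.prod_sum fun j a => if j = i then Real.negMulLog (q j a) else q j a,
    ← Finset.mul_prod_erase _ _ (Finset.mem_univ i),
    Finset.prod_eq_one, mul_one]
  · simp [hq]
  · intro j hj
    simp only [if_neg (Finset.ne_of_mem_erase hj)]
    exact sum_measureReal_fibers (hX j)

end Entropy

end

noncomputable section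

/-! ### The cut-set bound -/

namespace TwoLayerNetwork

open MeasureTheory

variable {t m : ℕ}

/-- Cutting the source edges to the relays that serve `A` attains the value. Conversely, each such
relay lies on a path from the source into `A`; these paths are edge-disjoint, and every cut contains
an edge of each. -/
theorem minCut_eq_card_biUnion (N : TwoLayerNetwork t m) (A : Finset (Fin m)) :
    N.minCut A = (A.biUnion N.M).card := by
  classical
  apply le_antisymm
  · refine Nat.sInf_le ⟨{v | match v with
      | Node.source => True
      | Node.relay j => j ∉ A.biUnion N.M
      | Node.dest i => i ∉ A}, trivial, fun i hi h => h hi, ?_⟩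
    rw [← Set.ncard_coe_finset, ← Set.ncard_image_of_injective _ Sum.inl_injective]
    congr 1
    ext e
    rcases e with j | ⟨i, j, hj⟩
    · simp [tail, head]
    · simp only [tail, head, Set.mem_image, Set.mem_ofPred_eq, reduceCtorEq, and_false,
        exists_false, false_iff, not_and, not_not, Finset.mem_biUnion, not_exists]
      exact fun h hi => h i hi hj
  · refine le_csInf ⟨_, Set.univ \ {v | ∃ i ∈ A, v = Node.dest i}, by simp, by simp, rfl⟩ ?_
    rintro _ ⟨U, hs, hd, rfl⟩
    have hex : ∀ j ∈ A.biUnion N.M, ∃ e : N.Edge, (N.tail e ∈ U ∧ N.head e ∉ U) ∧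
        (e = Sum.inl j ∨ N.tail e = Node.relay j) := by
      intro j hj
      obtain ⟨i, hi, hij⟩ := Finset.mem_biUnion.1 hj
      by_cases h : Node.relay j ∈ U
      · exact ⟨Sum.inr ⟨i, j, hij⟩, ⟨h, hd i hi⟩, Or.inr rfl⟩
      · exact ⟨Sum.inl j, ⟨hs, h⟩, Or.inl rfl⟩
    choose! f hf hf' using hex
    rw [← Set.ncard_coe_finset]
    refine Set.ncard_le_ncard_of_injOn f (fun j hj => hf j hj) ?_ (Set.toFinite _)
    intro j hj j' hj' h
    rcases hf' j hj with h1 | h1 <;> rcases hf' j' hj' with h2 | h2 <;> rw [h] at h1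
    · exact Sum.inl_injective (h1.symm.trans h2)
    · rw [h1] at h2
      simp [tail] at h2
    · rw [h2] at h1
      simp [tail] at h1
    · simpa using h1.symm.trans h2

variable {N : TwoLayerNetwork t m} {k n : ℕ} {F : Type*} [Field F] [Fintype F]
  {Ω : Type*} [MeasurableSpace Ω] {μ : Measure Ω} {𝒲 : Fin m → Type*} [∀ i, Fintype (𝒲 i)]
  {S : Type*} [MeasurableSpace S] {W : (i : Fin m) → Ω → 𝒲 i} {Θ : Ω → S}
  {X : N.Edge → Ω → (Fin n → F)}

namespace IsSecureCode

theorem hasMeasurableFibers_message (h : N.IsSecureCode k n F μ W Θ X) (i : Fin m) :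
    HasMeasurableFibers (W i) :=
  fun _ => h.measurable_message i trivial

theorem hasMeasurableFibers_messages (h : N.IsSecureCode k n F μ W Θ X) :
    HasMeasurableFibers fun ω i => W i ω :=
  .pi h.hasMeasurableFibers_message

theorem hasMeasurableFibers_relay (h : N.IsSecureCode k n F μ W Θ X) (j : Fin t) :
    HasMeasurableFibers (X (Sum.inl j)) := by
  obtain ⟨f, hf, hX⟩ := h.source_encoding (Sum.inl j) rfl
  -- `Θ` may take infinitely many values, so the fiber is sliced along the finitely many message
  -- values, where `f w` is measurable.
  intro x
  have : X (Sum.inl j) ⁻¹' {x} =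
      ⋃ w, ((fun ω i => W i ω) ⁻¹' {w} ∩ Θ ⁻¹' (f w ⁻¹' {x})) := by
    ext ω
    simp [hX]
  rw [this]
  exact MeasurableSet.iUnion fun w => (h.hasMeasurableFibers_messages w).inter
    (h.measurable_randomness (hf w trivial))

theorem factorsThrough_relay (h : N.IsSecureCode k n F μ W Θ X) (i : Fin m)
    (j : {j : Fin t // j ∈ N.M i}) :
    (X (Sum.inr ⟨i, j⟩)).FactorsThrough (X (Sum.inl j.1)) := by
  obtain ⟨f, hf⟩ := h.relay_encoding (Sum.inr ⟨i, j⟩) (by simp [tail])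
  intro ω ω' hω
  rw [hf, hf]
  congr 1
  funext ⟨l, hl⟩
  rcases l with l | l
  · obtain rfl : l = j.1 := by simpa [head, tail] using hl
    exact hω
  · simp [head, tail] at hl

/-- The relay symbols determine what a destination receives. -/
theorem incoming_factorsThrough (h : N.IsSecureCode k n F μ W Θ X) {A : Finset (Fin m)}
    {i : Fin m} (hi : i ∈ A) :
    (fun ω (e : N.InEdge (Node.dest i)) => X e.1 ω).FactorsThrough
      fun ω (j : {j // j ∈ A.biUnion N.M}) => X (Sum.inl j.1) ω := by
  intro ω ω' hω
  funext ⟨e, he⟩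
  rcases e with e | ⟨i', j⟩
  · simp [head] at he
  · obtain rfl : i' = i := by simpa [head] using he
    exact h.factorsThrough_relay i' j
      (congrFun hω ⟨j.1, Finset.mem_biUnion.2 ⟨i', hi, j.2⟩⟩)

theorem hasMeasurableFibers_relays (h : N.IsSecureCode k n F μ W Θ X) (U : Finset (Fin t)) :
    HasMeasurableFibers fun ω (j : U) => X (Sum.inl j.1) ω :=
  .pi fun j => h.hasMeasurableFibers_relay j.1

theorem hasMeasurableFibers_subfamily (h : N.IsSecureCode k n F μ W Θ X) (A : Finset (Fin m)) :
    HasMeasurableFibers fun ω (i : A) => W i ω :=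
  .pi fun i => h.hasMeasurableFibers_message i.1

theorem entropy_messages (h : N.IsSecureCode k n F μ W Θ X) :
    entropy μ (fun ω i => W i ω) = ∑ i, entropy μ (W i) := by
  have := h.isProbabilityMeasure
  refine entropy_pi_of_indep h.hasMeasurableFibers_message fun x => ?_
  have := (ProbabilityTheory.iIndepFun_iff_measure_inter_preimage_eq_mul.1 h.indep_messages)
    Finset.univ (sets := fun i => {x i}) fun _ _ => trivial
  simp only [Finset.mem_univ, Set.iInter_true] at this
  simp only [measureReal_def, this, ENNReal.toReal_prod]

/-- Zero-error decoding of a set of messages. -/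
theorem entropy_subfamily_relays_le (h : N.IsSecureCode k n F μ W Θ X) (A : Finset (Fin m)) :
    entropy μ (fun ω => ((fun i : A => W i ω),
        fun j : {j // j ∈ A.biUnion N.M} => X (Sum.inl j.1) ω)) ≤
      entropy μ (fun ω (j : {j // j ∈ A.biUnion N.M}) => X (Sum.inl j.1) ω) := by
  classical
  have := h.isProbabilityMeasure
  set Y := fun ω (j : {j // j ∈ A.biUnion N.M}) => X (Sum.inl j.1) ω
  have hY : HasMeasurableFibers Y := h.hasMeasurableFibers_relays _
  have hdec : ∀ i ∈ A, entropy μ (fun ω => (W i ω, Y ω)) ≤ entropy μ Y := by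
    intro i hi
    have hf := h.incoming_factorsThrough hi
    have hdec := h.decoding i
    rw [condEntropy, sub_eq_zero] at hdec
    -- A message with zero conditional entropy given what `i` receives keeps it given the finer
    -- variable `Y`.
    have := entropy_submodular (μ := μ) (T := fun ω => (W i ω, Y ω))
      ((h.hasMeasurableFibers_message i).prodMk (hY.of_factorsThrough hf)) hY
      (fun _ _ hab => congrArg Prod.snd hab) hf
      (fun _ _ hab => Prod.ext (congrArg (fun z => z.1.1) hab) (congrArg (fun z => z.2) hab))
    linarith
  have hsub : ∀ B ⊆ A, entropy μ (fun ω => ((fun i : B => W i ω), Y ω)) ≤ entropy μ Y := by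
    intro B
    induction B using Finset.induction_on with
    | empty =>
      intro _
      exact entropy_le_of_factorsThrough hY fun _ _ hab =>
        Prod.ext (funext fun i => absurd i.2 (Finset.notMem_empty _)) hab
    | insert i B hi ih =>
      intro hB
      have h1 := ih ((Finset.subset_insert i B).trans hB)
      have h2 := hdec i (hB (Finset.mem_insert_self i B))
      have := entropy_submodular (μ := μ)
        (T := fun ω => ((fun i' : (insert i B : Finset (Fin m)) => W i' ω), Y ω))
        ((h.hasMeasurableFibers_subfamily B).prodMk hY)
        ((h.hasMeasurableFibers_message i).prodMk hY)
        (Z := Y) (fun _ _ hab => congrArg Prod.snd hab) (fun _ _ hab => congrArg Prod.snd hab)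
        (fun _ _ hab => Prod.ext (funext fun ⟨i', hi'⟩ => by
          rcases Finset.mem_insert.1 hi' with rfl | hi''
          · exact congrArg (fun z => z.2.1) hab
          · exact congrFun (congrArg (fun z => z.1.1) hab) ⟨i', hi''⟩)
          (congrArg (fun z => z.2.2) hab))
      linarith
  exact hsub A subset_rfl

theorem entropy_le_card_mul (h : N.IsSecureCode k n F μ W Θ X) (U : Finset (Fin t)) :
    entropy μ (fun ω (j : U) => X (Sum.inl j.1) ω) ≤
      U.card * (n * Real.log (Fintype.card F)) := by
  have := h.isProbabilityMeasure
  refine (entropy_le_log_card (h.hasMeasurableFibers_relays U)).trans_eq ?_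
  simp [Real.log_pow]

/-- The cut-set bound with an eavesdropper who observes `k` of the relay symbols. -/
theorem sum_entropy_le (h : N.IsSecureCode k n F μ W Θ X) {A : Finset (Fin m)}
    (hA : k ≤ (A.biUnion N.M).card) :
    ∑ i ∈ A, entropy μ (W i) ≤
      (((A.biUnion N.M).card : ℝ) - k) * (n * Real.log (Fintype.card F)) := by
  classical
  have := h.isProbabilityMeasure
  set U := A.biUnion N.M
  obtain ⟨Z, hZU, hZ⟩ := Finset.exists_subset_card_eq hA
  set Y := fun ω (j : Z) => X (Sum.inl j.1) ω with hYdef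
  have hY : HasMeasurableFibers Y := h.hasMeasurableFibers_relays _
  have hsecret : entropy μ (fun ω i => W i ω) + entropy μ Y =
      entropy μ (fun ω => ((fun i => W i ω), Y ω)) := by
    -- The wiretapped edges are those from the source to the relays of `Z`.
    set Z' : Finset N.Edge := Z.map ⟨Sum.inl, Sum.inl_injective⟩
    have hs := h.secrecy Z' (by rw [Finset.card_map, hZ])
    rw [mutualInfo, condEntropy] at hs
    have hf : (fun ω (e : Z') => X e.1 ω).FactorsThrough Y := by
      rintro ω ω' hω
      funext ⟨e, he⟩
      obtain ⟨j, hj, rfl⟩ := Finset.mem_map.1 he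
      exact congrFun hω ⟨j, hj⟩
    have hf' : Y.FactorsThrough (fun ω (e : Z') => X e.1 ω) := by
      rintro ω ω' hω
      funext j
      exact congrFun hω ⟨Sum.inl j.1, Finset.mem_map.2 ⟨j.1, j.2, rfl⟩⟩
    rw [entropy_congr_of_factorsThrough hY hf hf',
      entropy_congr_of_factorsThrough (h.hasMeasurableFibers_messages.prodMk hY)
        (Y := fun ω => ((fun i => W i ω), fun (e : Z') => X e.1 ω))
        (fun _ _ hab => Prod.ext (congrArg (fun z => z.1) hab) (hf (congrArg (fun z => z.2) hab)))
        (fun _ _ hab => Prod.ext (congrArg (fun z => z.1) hab) (hf' (congrArg (fun z => z.2) hab)))]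
      at hs
    linarith
  -- Dropping the messages of `B` costs at most their entropies. With `B = Aᶜ` this subtracts
  -- exactly the unwanted part of the total message entropy.
  have hrest : ∀ B : Finset (Fin m), entropy μ (fun ω => ((fun i => W i ω), Y ω)) ≤
      entropy μ (fun ω => ((fun i : (Bᶜ : Finset (Fin m)) => W i ω), Y ω)) +
        ∑ i ∈ B, entropy μ (W i) := by
    intro B
    induction B using Finset.induction_on with
    | empty =>
      rw [Finset.sum_empty, add_zero]
      exact entropy_le_of_factorsThrough ((h.hasMeasurableFibers_subfamily _).prodMk hY)
        fun _ _ hab => Prod.ext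
          (funext fun i => congrFun (congrArg (fun z => z.1) hab) ⟨i, by simp⟩)
          (congrArg (fun z => z.2) hab)
    | insert i B hi ih =>
      refine ih.trans ?_
      rw [Finset.sum_insert hi, ← add_assoc]
      refine add_le_add_left (entropy_le_add ((h.hasMeasurableFibers_subfamily _).prodMk hY)
        (h.hasMeasurableFibers_message i) ?_) _
      intro ω ω' hab
      refine Prod.ext (funext fun ⟨i', hi'⟩ => ?_) (congrArg (fun z => z.1.2) hab)
      by_cases hii : i' = i
      · subst hii
        exact congrArg (fun z => z.2) hab
      · refine congrFun (congrArg (fun z => z.1.1) hab) ⟨i', ?_⟩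
        simp only [Finset.mem_compl, Finset.mem_insert] at hi' ⊢
        tauto
  have hrestA := hrest Aᶜ
  rw [compl_compl] at hrestA
  have hmono : entropy μ (fun ω => ((fun i : A => W i ω), Y ω)) ≤
      entropy μ (fun ω => ((fun i : A => W i ω), fun j : U => X (Sum.inl j.1) ω)) :=
    entropy_le_of_factorsThrough
      ((h.hasMeasurableFibers_subfamily A).prodMk (h.hasMeasurableFibers_relays U))
      fun _ _ hab => Prod.ext (congrArg (fun z => z.1) hab)
        (funext fun j => congrFun (congrArg (fun z => z.2) hab) ⟨j.1, hZU j.2⟩)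
  have hsplit : entropy μ (fun ω (j : U) => X (Sum.inl j.1) ω) ≤ entropy μ Y +
      entropy μ (fun ω (j : (U \ Z : Finset (Fin t))) => X (Sum.inl j.1) ω) := by
    refine entropy_le_add hY (h.hasMeasurableFibers_relays _) fun _ _ hab => funext fun j => ?_
    by_cases hj : j.1 ∈ Z
    · exact congrFun (congrArg (fun z => z.1) hab) ⟨j.1, hj⟩
    · exact congrFun (congrArg (fun z => z.2) hab) ⟨j.1, Finset.mem_sdiff.2 ⟨j.2, hj⟩⟩
  have hcard := h.entropy_le_card_mul (U \ Z)
  rw [Finset.card_sdiff_of_subset hZU, hZ, Nat.cast_sub hA] at hcard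
  have hdec := h.entropy_subfamily_relays_le A
  have htotal := h.entropy_messages
  rw [← Finset.sum_add_sum_compl A] at htotal
  linarith

end IsSecureCode

theorem secureCapacityRegion_subset (N : TwoLayerNetwork t m) {k : ℕ}
    (hk : ∀ i, k ≤ (N.M i).card) :
    N.secureCapacityRegion k ⊆ {R | (∀ i, 0 ≤ R i) ∧
      ∀ A : Finset (Fin m), A.Nonempty → ∑ i ∈ A, R i ≤ (N.minCut A : ℝ) - k} := by
  refine closure_minimal ?_ ?_
  · rintro R ⟨n, F, _, _, Ω, _, μ, 𝒲, _, S, _, W, Θ, X, hn, h, hR⟩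
    have := h.isProbabilityMeasure
    have hlog : 0 < Real.log (Fintype.card F) :=
      Real.log_pos (by exact_mod_cast Fintype.one_lt_card)
    have hn' : (0 : ℝ) < n := by exact_mod_cast hn
    refine ⟨fun i => ?_, fun A ⟨i, hi⟩ => ?_⟩
    · rw [hR, rate]
      exact div_nonneg (div_nonneg (entropy_nonneg _) hlog.le) hn'.le
    · have hb := h.sum_entropy_le (A := A)
        ((hk i).trans (Finset.card_le_card (Finset.subset_biUnion_of_mem N.M hi)))
      simp only [hR, rate, ← Finset.sum_div]
      rw [minCut_eq_card_biUnion, div_le_iff₀ hn', div_le_iff₀ hlog]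
      linarith
  · simp only [Set.ofPred_and, Set.ofPred_forall]
    refine (isClosed_iInter fun i => isClosed_le continuous_const (continuous_apply i)).inter
      (isClosed_iInter fun A => isClosed_iInter fun _ => isClosed_le ?_ continuous_const)
    exact continuous_finsetSum _ fun i _ => continuous_apply i

end TwoLayerNetwork

end

noncomputable section

/-! ### Linearly independent transversals -/

section Transversal

open Module Submodule

variable {K V : Type*} [Field K] [AddCommGroup V] [Module K V]

/-- **Rado's theorem** for finite sets of vectors. -/
theorem exists_linearIndependent_transversal {ι : Type*} [Fintype ι] (E : ι → Finset V)
    (h : ∀ J : Finset ι, J.card ≤ finrank K (J.sup fun i => span K (E i : Set V) : Submodule K V)) :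
    ∃ x : ι → V, (∀ i, x i ∈ E i) ∧ LinearIndependent K x := by
  classical
  induction hN : ∑ i, (E i).card using Nat.strong_induction_on generalizing E with
  | _ N ih =>
    -- Induction on the total size: delete an element from a set with at least two as long as the
    -- rank condition survives. When only singletons remain, the condition for all indices is linear
    -- independence.
    by_cases hcard : ∀ i, (E i).card ≤ 1
    · have hne : ∀ i, ∃ x, E i = {x} := by
        intro i
        refine Finset.card_eq_one.1 ((hcard i).antisymm (Finset.card_pos.2 ?_))
        by_contra h0
        have := h {i}
        simp [Finset.not_nonempty_iff_eq_empty.1 h0] at this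
      choose x hx using hne
      refine ⟨x, fun i => by simp [hx i], ?_⟩
      rw [linearIndependent_iff_card_le_finrank_span, Set.finrank, span_range_eq_iSup]
      have hsup : (Finset.univ.sup fun i => span K (E i : Set V)) = ⨆ i, span K {x i} := by
        simp [hx, Finset.sup_univ_eq_iSup]
      rw [← hsup]
      exact h Finset.univ
    · push Not at hcard
      obtain ⟨i, hi⟩ := hcard
      obtain ⟨x, hx, y, hy, hxy⟩ := Finset.one_lt_card.1 hi
      -- If deleting `z` breaks the rank condition, the violating index set must contain `i`; `J` is
      -- that set without `i`.
      have step : ∀ z ∈ E i, (∃ x : ι → V, (∀ i, x i ∈ E i) ∧ LinearIndependent K x) ∨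
          ∃ J : Finset ι, i ∉ J ∧ finrank K (span K ((E i).erase z : Set V) ⊔
            J.sup fun i => span K (E i : Set V) : Submodule K V) ≤ J.card := by
        intro z hz
        by_cases hJ : ∀ J : Finset ι, J.card ≤ finrank K (J.sup fun j =>
            span K (Function.update E i ((E i).erase z) j : Set V) : Submodule K V)
        · left
          obtain ⟨x, hx, hli⟩ := ih (∑ j, (Function.update E i ((E i).erase z) j).card) (by
            rw [← hN]
            refine Finset.sum_lt_sum (fun j _ => ?_) ⟨i, Finset.mem_univ i, ?_⟩
            · rcases eq_or_ne j i with rfl | hj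
              · simpa using Finset.card_le_card (Finset.erase_subset _ _)
              · simp [hj]
            · simpa using Finset.card_erase_lt_of_mem hz) _ hJ rfl
          refine ⟨x, fun j => ?_, hli⟩
          have := hx j
          rcases eq_or_ne j i with rfl | hj
          · exact Finset.mem_of_mem_erase (by simpa using this)
          · simpa [hj] using this
        · right
          push Not at hJ
          obtain ⟨J, hJ⟩ := hJ
          have hcongr : ∀ J : Finset ι, i ∉ J →
              (J.sup fun j => span K (Function.update E i ((E i).erase z) j : Set V)) =
                J.sup fun j => span K (E j : Set V) := by
            intro J hiJ
            refine Finset.sup_congr rfl fun j hj => ?_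
            rw [Function.update_of_ne (ne_of_mem_of_not_mem hj hiJ)]
          by_cases hiJ : i ∈ J
          · refine ⟨J.erase i, Finset.notMem_erase i J, ?_⟩
            rw [← Finset.insert_erase hiJ, Finset.sup_insert, hcongr _ (Finset.notMem_erase i J),
              Function.update_self, Finset.card_insert_of_notMem (Finset.notMem_erase i J)] at hJ
            omega
          · rw [hcongr J hiJ] at hJ
            exact absurd (h J) (not_le.2 hJ)
      rcases step x hx with hres | ⟨J, hiJ, hJ⟩
      · exact hres
      rcases step y hy with hres | ⟨L, hiL, hL⟩
      · exact hres
      exfalso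
      set D : ι → Submodule K V := fun i => span K (E i : Set V) with hD
      -- If neither `x` nor `y` may be deleted, the dimension formula contradicts the rank condition
      -- at `insert i (J ∪ L)` and `J ∩ L`: together these demand `J.card + L.card + 1`, but only
      -- `J.card + L.card` is available.
      have h1 : (insert i (J ∪ L)).sup D ≤
          (span K ((E i).erase x : Set V) ⊔ J.sup D) ⊔ (span K ((E i).erase y : Set V) ⊔ L.sup D) := by
        rw [Finset.sup_insert, Finset.sup_union, sup_sup_sup_comm]
        refine sup_le_sup_right (?_ : span K _ ≤ _) _
        rw [← span_union]
        refine span_mono fun v hv => ?_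
        by_cases hvx : v = x
        · exact Or.inr (by simp only [Finset.mem_coe, Finset.mem_erase] at hv ⊢; exact ⟨hvx ▸ hxy, hv⟩)
        · exact Or.inl (by simp only [Finset.mem_coe, Finset.mem_erase] at hv ⊢; exact ⟨hvx, hv⟩)
      have h2 : (J ∩ L).sup D ≤
          (span K ((E i).erase x : Set V) ⊔ J.sup D) ⊓ (span K ((E i).erase y : Set V) ⊔ L.sup D) :=
        le_inf ((Finset.sup_mono Finset.inter_subset_left).trans le_sup_right)
          ((Finset.sup_mono Finset.inter_subset_right).trans le_sup_right)
      have h3 := finrank_sup_add_finrank_inf_eq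
        (span K ((E i).erase x : Set V) ⊔ J.sup D) (span K ((E i).erase y : Set V) ⊔ L.sup D)
      have h4 := (h (insert i (J ∪ L))).trans (finrank_mono h1)
      have h5 := (h (J ∩ L)).trans (finrank_mono h2)
      rw [Finset.card_insert_of_notMem (by simp [hiJ, hiL])] at h4
      have := Finset.card_union_add_card_inter J L
      omega

end Transversal

end

noncomputable section

/-! ### The decoding spaces -/

namespace TwoLayerNetwork

open Module Submodule

variable {t m : ℕ} {F : Type*} [Field F]

/-- The vectors in the left null space of the Vandermonde matrix that are supported on `U`. -/
def supportedKernel (k : ℕ) (a : Fin t → F) (U : Finset (Fin t)) : Submodule F (Fin t → F) where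
  carrier := {x | (vandermondeMatrix k a)ᵀ *ᵥ x = 0 ∧ ∀ j ∉ U, x j = 0}
  add_mem' := fun ⟨h1, h2⟩ ⟨h3, h4⟩ =>
    ⟨by rw [Matrix.mulVec_add, h1, h3, add_zero], fun j hj => by simp [h2 j hj, h4 j hj]⟩
  zero_mem' := ⟨Matrix.mulVec_zero _, fun _ _ => rfl⟩
  smul_mem' := fun c x ⟨h1, h2⟩ =>
    ⟨by rw [Matrix.mulVec_smul, h1, smul_zero], fun j hj => by simp [h2 j hj]⟩

theorem mem_supportedKernel {k : ℕ} {a : Fin t → F} {U : Finset (Fin t)} {x : Fin t → F} :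
    x ∈ supportedKernel k a U ↔ (vandermondeMatrix k a)ᵀ *ᵥ x = 0 ∧ ∀ j ∉ U, x j = 0 :=
  Iff.rfl

theorem decodingSpace_eq_supportedKernel (N : TwoLayerNetwork t m) (k : ℕ) (a : Fin t → F)
    (i : Fin m) : N.decodingSpace k a i = supportedKernel k a (N.M i) := by
  ext x
  have h : ∀ j, (N.unconnectedMatrix F i *ᵥ x) j = x j := by
    intro j
    simp [unconnectedMatrix, Matrix.mulVec, dotProduct]
  rw [mem_supportedKernel, decodingSpace, LinearMap.mem_ker, Matrix.mulVecLin_apply,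
    Matrix.fromRows_mulVec]
  constructor
  · intro hx
    refine ⟨funext fun l => congrFun hx (Sum.inl l), fun j hj => ?_⟩
    rw [← h ⟨j, hj⟩]
    exact congrFun hx (Sum.inr ⟨j, hj⟩)
  · rintro ⟨h1, h2⟩
    funext p
    rcases p with l | j
    · exact congrFun h1 l
    · exact (h j).trans (h2 j j.2)

/-- Any `k` rows of the Vandermonde matrix at distinct points form an invertible square matrix, so
`k` positions inside `U` suffice to solve the system. -/
theorem exists_supported_vandermonde_mulVec_eq {k : ℕ} {a : Fin t → F}
    (ha : Function.Injective a) {U : Finset (Fin t)} (hU : k ≤ U.card) (c : Fin k → F) :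
    ∃ w : Fin t → F, (vandermondeMatrix k a)ᵀ *ᵥ w = c ∧ ∀ j ∉ U, w j = 0 := by
  obtain ⟨S, hSU, hS⟩ := Finset.exists_subset_card_eq hU
  set e := S.orderEmbOfFin hS
  have hdet : IsUnit (Matrix.vandermonde (a ∘ e)).det :=
    (Matrix.det_vandermonde_ne_zero_iff.2 (ha.comp e.injective)).isUnit
  set u := c ᵥ* (Matrix.vandermonde (a ∘ e))⁻¹
  refine ⟨∑ l, u l • Pi.single (e l) 1, ?_, fun j hj => ?_⟩
  · have h1 : u ᵥ* Matrix.vandermonde (a ∘ e) = c := by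
      rw [Matrix.vecMul_vecMul, Matrix.nonsing_inv_mul _ hdet, Matrix.vecMul_one]
    rw [← h1, Matrix.mulVec_sum]
    funext l
    simp [Matrix.mulVec_smul, Matrix.vecMul, dotProduct, vandermondeMatrix, Matrix.vandermonde]
  · rw [Finset.sum_apply]
    refine Finset.sum_eq_zero fun l _ => ?_
    have : j ≠ e l := fun h => hj (hSU (h ▸ S.orderEmbOfFin_mem hS l))
    simp [this]

/-- Restrict `x` to `U` and repair the `k` violated equations by a correction `w` supported on `U ∩
U'`. The repaired part and the rest then both stay in the kernel, with supports in `U` and `U'`. -/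
theorem supportedKernel_union_le {k : ℕ} {a : Fin t → F} (ha : Function.Injective a)
    {U U' : Finset (Fin t)} (h : k ≤ (U ∩ U').card) :
    supportedKernel k a (U ∪ U') ≤ supportedKernel k a U ⊔ supportedKernel k a U' := by
  classical
  rintro x ⟨hx, hsupp⟩
  set y : Fin t → F := fun j => if j ∈ U then x j else 0 with hy
  obtain ⟨w, hw, hw0⟩ := exists_supported_vandermonde_mulVec_eq ha h ((vandermondeMatrix k a)ᵀ *ᵥ y)
  refine mem_sup.2 ⟨y - w, ⟨?_, fun j hj => ?_⟩, x - (y - w), ⟨?_, fun j hj => ?_⟩, by abel⟩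
  · rw [Matrix.mulVec_sub, hw, sub_self]
  · simp [hy, hj, hw0 j (fun h => hj (Finset.mem_inter.1 h).1)]
  · rw [Matrix.mulVec_sub, Matrix.mulVec_sub, hw, sub_self, sub_zero, hx]
  · by_cases hjU : j ∈ U
    · simp [hy, hjU, hw0 j (fun h => hj (Finset.mem_inter.1 h).2)]
    · simp [hy, hjU, hw0 j (fun h => hj (Finset.mem_inter.1 h).2), hsupp j (by simp [hj, hjU])]

theorem supportedKernel_biUnion_le (N : TwoLayerNetwork t m) {k : ℕ} {a : Fin t → F}
    (ha : Function.Injective a) (hM : ∀ i j, i ≠ j → k ≤ (N.M i ∩ N.M j).card)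
    {A : Finset (Fin m)} (hA : A.Nonempty) :
    supportedKernel k a (A.biUnion N.M) ≤ A.sup fun i => supportedKernel k a (N.M i) := by
  classical
  induction hA using Finset.Nonempty.cons_induction with
  | singleton i => simp
  | cons i A hi hA ih =>
    obtain ⟨j, hj⟩ := hA
    rw [Finset.cons_eq_insert, Finset.biUnion_insert, Finset.sup_insert]
    refine (supportedKernel_union_le ha ?_).trans (sup_le_sup_left ih _)
    exact (hM i j (ne_of_mem_of_not_mem hj hi).symm).trans (Finset.card_le_card
      (Finset.inter_subset_inter_left (Finset.subset_biUnion_of_mem N.M hj)))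

/-- Rank-nullity: `k` linear equations on the vectors supported on `U`. -/
theorem card_le_finrank_supportedKernel_add (k : ℕ) (a : Fin t → F) (U : Finset (Fin t)) :
    U.card ≤ finrank F (supportedKernel k a U) + k := by
  set ext := Function.ExtendByZero.linearMap F (Subtype.val : U → Fin t)
  have hinj : Function.Injective ext := by
    intro x y hxy
    funext j
    have h : Function.extend Subtype.val x 0 (j : Fin t) = Function.extend Subtype.val y 0 (j : Fin t) :=
      congrFun hxy j
    rwa [Subtype.val_injective.extend_apply, Subtype.val_injective.extend_apply] at h
  set f : (U → F) →ₗ[F] (Fin k → F) := (vandermondeMatrix k a)ᵀ.mulVecLin ∘ₗ ext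
  have h1 := LinearMap.finrank_range_add_finrank_ker f
  have h2 : finrank F (LinearMap.range f) ≤ k := by
    simpa using Submodule.finrank_le (LinearMap.range f)
  have h3 : (LinearMap.ker f).map ext ≤ supportedKernel k a U := by
    rintro _ ⟨x, hx, rfl⟩
    refine ⟨hx, fun j hj => ?_⟩
    exact Function.extend_apply' _ _ _ (by rintro ⟨j', rfl⟩; exact hj j'.2)
  have h4 := finrank_mono h3
  rw [← (Submodule.equivMapOfInjective ext hinj _).finrank_eq] at h4
  simp at h1
  omega

/-- The span on the right contains a copy of `A.sup D` in each of the `n` channel uses, hence their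
direct sum. -/
theorem mul_finrank_sup_le_finrank_sup_single [Finite F] {n : ℕ} {ι : Type*} (A : Finset ι)
    (D : ι → Submodule F (Fin t → F)) (E : ι → Finset (Fin n → Fin t → F))
    (hE : ∀ i s, ∀ v ∈ D i, Pi.single s v ∈ E i) :
    n * finrank F (A.sup D : Submodule F (Fin t → F)) ≤
      finrank F (A.sup fun i => span F (E i : Set (Fin n → Fin t → F)) :
        Submodule F (Fin n → Fin t → F)) := by
  classical
  set P := A.sup D
  set Q := A.sup fun i => span F (E i : Set (Fin n → Fin t → F))
  have hsingle : ∀ s, P ≤ Q.comap (LinearMap.single F (fun _ : Fin n => Fin t → F) s) := by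
    refine fun s => Finset.sup_le fun i hi v hv => ?_
    exact (Finset.le_sup (f := fun i => span F (E i : Set (Fin n → Fin t → F))) hi)
      (subset_span (hE i s v hv))
  set g : (Fin n → P) →ₗ[F] (Fin n → Fin t → F) := P.subtype.compLeft (Fin n)
  have hg : Function.Injective g := by
    intro x y hxy
    funext s
    exact Subtype.ext (congrFun hxy s)
  have hrange : LinearMap.range g ≤ Q := by
    rintro _ ⟨x, rfl⟩
    rw [← Finset.univ_sum_single (g x)]
    exact Q.sum_mem fun s _ => hsingle s (x s).2
  have := finrank_mono hrange
  rwa [LinearMap.finrank_range_of_inj hg, finrank_pi_fintype, Finset.sum_const,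
    Finset.card_univ, Fintype.card_fin, smul_eq_mul] at this

/-- Each vector lives in a single channel use `σ p`; sorting by it, `r s i` counts those of
destination `i` in use `s`. Independence within one use is inherited through the embedding
`Pi.single s`. -/
theorem exists_regroup {n : ℕ} {c : Fin m → ℕ} {v : (Σ i : Fin m, Fin (c i)) → Fin t → F}
    {σ : (Σ i : Fin m, Fin (c i)) → Fin n}
    (hli : LinearIndependent F fun p => (Pi.single (σ p) (v p) : Fin n → Fin t → F)) :
    ∃ (r : Fin n → Fin m → ℕ) (T : (s : Fin n) → Matrix (Σ i : Fin m, Fin (r s i)) (Fin t) F),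
      (∀ s p, ∃ l, T s p = v ⟨p.1, l⟩) ∧ (∀ s, LinearIndependent F (T s)) ∧
      ∀ i, ∑ s, r s i = c i := by
  obtain ⟨r, ⟨e⟩⟩ : ∃ r : Fin n → Fin m → ℕ,
      Nonempty (∀ s i, Fin (r s i) ≃ {l : Fin (c i) // σ ⟨i, l⟩ = s}) :=
    ⟨_, ⟨fun s i => (Fintype.equivFin _).symm⟩⟩
  refine ⟨r, fun s p => v ⟨p.1, (e s p.1 p.2).1⟩, fun s p => ⟨_, rfl⟩, fun s => ?_, fun i => ?_⟩
  · have h1 : Function.Injective fun p : Σ i : Fin m, Fin (r s i) =>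
        (⟨p.1, (e s p.1 p.2).1⟩ : Σ i, Fin (c i)) := by
      rintro ⟨i, l⟩ ⟨i', l'⟩ h
      obtain rfl : i = i' := congrArg Sigma.fst h
      simpa [Subtype.val_injective.eq_iff] using h
    have h2 : (LinearMap.single F (fun _ : Fin n => Fin t → F) s ∘
        fun p : Σ i : Fin m, Fin (r s i) => v ⟨p.1, (e s p.1 p.2).1⟩) =
          (fun p => Pi.single (σ p) (v p)) ∘ fun p => ⟨p.1, (e s p.1 p.2).1⟩ := by
      funext p
      simp only [Function.comp_apply, (e s p.1 p.2).2]
      rfl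
    refine LinearIndependent.of_comp (LinearMap.single F (fun _ : Fin n => Fin t → F) s) ?_
    rw [h2]
    exact hli.comp _ h1
  · calc ∑ s, r s i = ∑ s, Fintype.card {l : Fin (c i) // σ ⟨i, l⟩ = s} :=
          Finset.sum_congr rfl fun s _ => by rw [← Fintype.card_congr (e s i), Fintype.card_fin]
      _ = c i := by
          rw [← Fintype.card_sigma, Fintype.card_congr (Equiv.sigmaFiberEquiv fun l => σ ⟨i, l⟩),
            Fintype.card_fin]

/-- The `c i` decoding vectors of destination `i` in `n` channel uses, with `r s i` of them in
channel use `s`. -/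
theorem exists_decodingVectors [Finite F] (N : TwoLayerNetwork t m) {k : ℕ}
    (hM : ∀ i j, i ≠ j → k ≤ (N.M i ∩ N.M j).card) {a : Fin t → F} (ha : Function.Injective a)
    {n : ℕ} (c : Fin m → ℕ)
    (hc : ∀ A : Finset (Fin m), A.Nonempty → ∑ i ∈ A, c i + n * k ≤ n * (A.biUnion N.M).card) :
    ∃ (r : Fin n → Fin m → ℕ) (T : (s : Fin n) → Matrix (Σ i : Fin m, Fin (r s i)) (Fin t) F),
      (∀ s p, T s p ∈ N.decodingSpace k a p.1) ∧ (∀ s, LinearIndependent F (T s)) ∧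
      ∀ i, ∑ s, r s i = c i := by
  classical
  have hfin : ∀ i, {x : Fin n → Fin t → F |
      ∃ s, ∃ v ∈ N.decodingSpace k a i, Pi.single s v = x}.Finite := fun i => Set.toFinite _
  set E : Fin m → Finset (Fin n → Fin t → F) := fun i => (hfin i).toFinset with hE
  have hmem : ∀ i x, x ∈ E i ↔ ∃ s, ∃ v ∈ N.decodingSpace k a i, Pi.single s v = x := by
    simp [hE]
  -- Destination `i` is repeated `c i` times as an index, so only the set `A` of destinations met by
  -- `J` matters: `J.card ≤ ∑ i ∈ A, c i`, which is at most `n` times the dimension of the joint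
  -- decoding space.
  have hrado : ∀ J : Finset (Σ i : Fin m, Fin (c i)), J.card ≤ finrank F
      (J.sup fun p => span F (E p.1 : Set (Fin n → Fin t → F)) :
        Submodule F (Fin n → Fin t → F)) := by
    intro J
    rcases J.eq_empty_or_nonempty with rfl | hJ
    · simp
    set A := J.image Sigma.fst
    have hA : A.Nonempty := hJ.image _
    have h1 : J.card ≤ ∑ i ∈ A, c i := by
      have : J ⊆ A.sigma fun i => Finset.univ := fun p hp =>
        Finset.mem_sigma.2 ⟨Finset.mem_image_of_mem _ hp, Finset.mem_univ _⟩
      simpa using Finset.card_le_card this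
    have h2 := card_le_finrank_supportedKernel_add k a (A.biUnion N.M)
    have h3 := finrank_mono (supportedKernel_biUnion_le N ha hM hA)
    have h4 := mul_finrank_sup_le_finrank_sup_single A (fun i => supportedKernel k a (N.M i)) E
      fun i s v hv => (hmem i _).2 ⟨s, v, (N.decodingSpace_eq_supportedKernel k a i).symm ▸ hv, rfl⟩
    have h5 : (A.sup fun i => span F (E i : Set (Fin n → Fin t → F))) =
        J.sup fun p => span F (E p.1 : Set (Fin n → Fin t → F)) := Finset.sup_image _ _ _
    rw [h5] at h4
    have h6 := hc A hA
    have h7 := Nat.mul_le_mul_left n (h2.trans (Nat.add_le_add_right h3 k))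
    rw [mul_add] at h7
    omega
  obtain ⟨x, hxE, hli⟩ := exists_linearIndependent_transversal (fun p : Σ i, Fin (c i) => E p.1) hrado
  choose σ v hv hσ using fun p => (hmem _ _).1 (hxE p)
  obtain ⟨r, T, hT, hind, hr⟩ := exists_regroup (v := v) (σ := σ) (by
    rw [funext hσ]
    exact hli)
  refine ⟨r, T, fun s p => ?_, hind, hr⟩
  obtain ⟨l, hl⟩ := hT s p
  rw [hl]
  exact hv ⟨p.1, l⟩

end TwoLayerNetwork

end

noncomputable section

/-! ### Uniformly distributed variables -/

section Uniform

open MeasureTheory ProbabilityTheory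

theorem hasMeasurableFibers_of_discrete {Ω α : Type*} [MeasurableSpace Ω]
    [DiscreteMeasurableSpace Ω] (X : Ω → α) : HasMeasurableFibers X :=
  fun _ => .of_discrete

variable {Ω : Type*} [Fintype Ω] [MeasurableSpace Ω] [DiscreteMeasurableSpace Ω]

theorem uniformOn_univ_real (s : Set Ω) :
    (uniformOn (Set.univ : Set Ω)).real s = s.ncard / Fintype.card Ω := by
  rw [measureReal_def, uniformOn_univ, ENNReal.toReal_div, Measure.count_apply (.of_discrete),
    ← s.toFinite.cast_ncard_eq, ENat.toENNReal_coe, ENNReal.toReal_natCast,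
    ENNReal.toReal_natCast]

theorem entropy_uniformOn_comp_equiv {α : Type*} [Fintype α] (X : Ω → α) (φ : Ω ≃ Ω) :
    entropy (uniformOn Set.univ) (fun ω => X (φ ω)) = entropy (uniformOn Set.univ) X := by
  refine Finset.sum_congr rfl fun x _ => ?_
  rw [uniformOn_univ_real, uniformOn_univ_real]
  congr 3
  change Set.ncard (φ ⁻¹' (X ⁻¹' {x})) = _
  exact Set.ncard_preimage_of_injective_subset_range φ.injective (by simp)

theorem uniformOn_univ_real_inter {β κ : Type*} [Fintype β] [Fintype κ] (φ : Ω ≃ β × κ)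
    (s : Set β) (u : Set κ) :
    (uniformOn (Set.univ : Set Ω)).real
        ((fun ω => (φ ω).1) ⁻¹' s ∩ (fun ω => (φ ω).2) ⁻¹' u) =
      (s.ncard / Fintype.card β) * (u.ncard / Fintype.card κ) := by
  have h : (fun ω => (φ ω).1) ⁻¹' s ∩ (fun ω => (φ ω).2) ⁻¹' u = φ ⁻¹' (s ×ˢ u) := rfl
  rw [uniformOn_univ_real, h, Set.ncard_preimage_of_injective_subset_range φ.injective (by simp),
    Set.ncard_prod, Fintype.card_congr φ, Fintype.card_prod]
  push_cast
  rw [mul_div_mul_comm]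

theorem uniformOn_univ_real_preimage_fst {β κ : Type*} [Fintype β] [Fintype κ] [Nonempty κ]
    (φ : Ω ≃ β × κ) (s : Set β) :
    (uniformOn (Set.univ : Set Ω)).real ((fun ω => (φ ω).1) ⁻¹' s) = s.ncard / Fintype.card β := by
  have := uniformOn_univ_real_inter φ s Set.univ
  simpa using this

theorem uniformOn_univ_real_preimage_snd {β κ : Type*} [Fintype β] [Fintype κ] [Nonempty β]
    (φ : Ω ≃ β × κ) (u : Set κ) :
    (uniformOn (Set.univ : Set Ω)).real ((fun ω => (φ ω).2) ⁻¹' u) = u.ncard / Fintype.card κ := by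
  have := uniformOn_univ_real_inter φ Set.univ u
  simpa using this

variable {ι κ : Type*} [Fintype ι] [DecidableEq ι] [Fintype κ] [Nonempty κ] {α : ι → Type*}
  [∀ i, Fintype (α i)]

theorem uniformOn_univ_real_pi (φ : Ω ≃ ((i : ι) → α i) × κ) (s : (i : ι) → Set (α i)) :
    (uniformOn (Set.univ : Set Ω)).real (⋂ i, (fun ω => (φ ω).1 i) ⁻¹' s i) =
      ∏ i, ((s i).ncard / Fintype.card (α i) : ℝ) := by
  classical
  have h : (⋂ i, (fun ω => (φ ω).1 i) ⁻¹' s i) = (fun ω => (φ ω).1) ⁻¹' Set.univ.pi s := by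
    ext; simp
  have h2 : Set.univ.pi s = (Fintype.piFinset fun i => (s i).toFinset : Set ((i : ι) → α i)) := by
    ext; simp
  rw [h, uniformOn_univ_real_preimage_fst, h2, Set.ncard_coe_finset, Fintype.card_piFinset,
    Fintype.card_pi, Finset.prod_div_distrib]
  simp [Set.ncard_eq_toFinset_card']

theorem uniformOn_univ_real_preimage_eval [∀ i, Nonempty (α i)] (φ : Ω ≃ ((i : ι) → α i) × κ)
    (i : ι) (s : Set (α i)) :
    (uniformOn (Set.univ : Set Ω)).real ((fun ω => (φ ω).1 i) ⁻¹' s) =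
      s.ncard / Fintype.card (α i) := by
  have h := uniformOn_univ_real_pi φ (Function.update (fun i => Set.univ) i s)
  rw [← Finset.mul_prod_erase _ _ (Finset.mem_univ i), Finset.prod_eq_one fun j hj => by
    simp [Finset.ne_of_mem_erase hj], mul_one, Function.update_self] at h
  rw [← h]
  congr 1
  ext ω
  simp only [Set.mem_preimage, Set.mem_iInter]
  refine ⟨fun hω j => ?_, fun hω => by simpa using hω i⟩
  rcases eq_or_ne j i with rfl | hj
  · simpa using hω
  · simp [hj]

theorem indepFun_uniformOn_univ {β : Type*} [Fintype β] [Nonempty β] [MeasurableSpace β]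
    [MeasurableSpace κ] (φ : Ω ≃ β × κ) :
    IndepFun (fun ω => (φ ω).1) (fun ω => (φ ω).2) (uniformOn (Set.univ : Set Ω)) := by
  rw [indepFun_iff_measure_inter_preimage_eq_mul]
  intro s u _ _
  have : Nonempty Ω := φ.nonempty
  have := isProbabilityMeasure_uniformOn (Set.finite_univ (α := Ω)) Set.univ_nonempty
  rw [← ENNReal.toReal_eq_toReal_iff' (measure_ne_top _ _)
    (ENNReal.mul_ne_top (measure_ne_top _ _) (measure_ne_top _ _)), ENNReal.toReal_mul]
  simp only [← measureReal_def]
  rw [uniformOn_univ_real_inter, uniformOn_univ_real_preimage_fst, uniformOn_univ_real_preimage_snd]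

theorem iIndepFun_uniformOn_univ [∀ i, Nonempty (α i)] [m : ∀ i, MeasurableSpace (α i)]
    (φ : Ω ≃ ((i : ι) → α i) × κ) :
    iIndepFun (fun i ω => (φ ω).1 i) (uniformOn (Set.univ : Set Ω)) := by
  rw [iIndepFun_iff_measure_inter_preimage_eq_mul]
  intro S s _
  have : Nonempty Ω := φ.nonempty
  have := isProbabilityMeasure_uniformOn (Set.finite_univ (α := Ω)) Set.univ_nonempty
  rw [← ENNReal.toReal_eq_toReal_iff' (measure_ne_top _ _)
    (ENNReal.prod_ne_top fun _ _ => measure_ne_top _ _), ENNReal.toReal_prod]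
  simp only [← measureReal_def]
  have h : (⋂ i ∈ S, (fun ω => (φ ω).1 i) ⁻¹' s i) =
      ⋂ i, (fun ω => (φ ω).1 i) ⁻¹' (if i ∈ S then s i else Set.univ) := by
    ext ω
    simp only [Set.mem_iInter, Set.mem_preimage]
    refine forall_congr' fun i => ?_
    by_cases hi : i ∈ S <;> simp [hi]
  rw [h, uniformOn_univ_real_pi, Finset.prod_congr rfl fun i _ =>
    uniformOn_univ_real_preimage_eval φ i (s i), ← Finset.prod_subset (Finset.subset_univ S)]
  · exact Finset.prod_congr rfl fun i hi => by rw [if_pos hi]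
  · intro i _ hi
    simp [hi]

theorem entropy_uniformOn_univ_eval [∀ i, Nonempty (α i)] (φ : Ω ≃ ((i : ι) → α i) × κ) (i : ι) :
    entropy (uniformOn (Set.univ : Set Ω)) (fun ω => (φ ω).1 i) =
      Real.log (Fintype.card (α i)) := by
  have hne : (Fintype.card (α i) : ℝ) ≠ 0 := by simp
  simp only [entropy, uniformOn_univ_real_preimage_eval, Set.ncard_singleton]
  simp [Real.negMulLog, hne]

end Uniform

/-! ### The scheme is a secure code -/

namespace TwoLayerNetwork

open MeasureTheory ProbabilityTheory

variable {t m : ℕ} {F : Type*} [Field F]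

/-- The coefficients of the Lagrange interpolation polynomial through the points of `J`, whose
degree is below `k`. Hence the random packets can produce any symbols on at most `k` relays. -/
theorem exists_vandermonde_mulVec_eq_on {k : ℕ} {a : Fin t → F} (ha : Function.Injective a)
    {J : Finset (Fin t)} (hJ : J.card ≤ k) (y : Fin t → F) :
    ∃ κ : Fin k → F, ∀ j ∈ J, (vandermondeMatrix k a *ᵥ κ) j = y j := by
  classical
  set p := Lagrange.interpolate J a y
  have hp : p.degree < k :=
    (Lagrange.degree_interpolate_lt y ha.injOn).trans_le (by exact_mod_cast hJ)
  refine ⟨fun l => p.coeff l, fun j hj => ?_⟩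
  rw [← Lagrange.eval_interpolate_at_node y ha.injOn hj]
  have hk : 0 < k := (Finset.card_pos.2 ⟨j, hj⟩).trans_le hJ
  have hp' : p.natDegree < k := by
    by_cases h0 : p = 0
    · simpa [h0] using hk
    · exact (Polynomial.natDegree_lt_iff_degree_lt h0).2 hp
  rw [Polynomial.eval_eq_sum_range' hp', Finset.sum_range]
  simp [Matrix.mulVec, dotProduct, vandermondeMatrix, mul_comm]

/-- Full row rank makes `T` surjective on vectors. -/
theorem exists_mul_eq_one_of_linearIndependent {R C : Type*} [Fintype R] [DecidableEq R]
    [Fintype C] [DecidableEq C] {T : Matrix R C F} (hT : LinearIndependent F T) :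
    ∃ G : Matrix C R F, T * G = 1 := by
  rw [← Matrix.mulVec_surjective_iff_exists_right_inverse]
  change Function.Surjective T.mulVecLin
  refine LinearMap.range_eq_top.1 (Submodule.eq_top_of_finrank_eq ?_)
  rw [Module.finrank_fintype_fun_eq_card]
  exact LinearIndependent.rank_matrix hT

variable {k n : ℕ} {r : Fin n → Fin m → ℕ}

/-- The relay whose symbol an edge carries. -/
def edgeRelay (N : TwoLayerNetwork t m) : N.Edge → Fin t
  | Sum.inl j => j
  | Sum.inr e => e.2.1

theorem schemeTransmission_apply (N : TwoLayerNetwork t m) (a : Fin t → F)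
    (G : (s : Fin n) → Matrix (Fin t) (Σ i : Fin m, Fin (r s i)) F) (e : N.Edge)
    (ω : SchemeSpace F k n r) :
    N.schemeTransmission a G e ω = fun s => relaySymbols a G ω s (N.edgeRelay e) := by
  rcases e with e | e <;> rfl

theorem schemeMessage_eq_mulVec (N : TwoLayerNetwork t m) {a : Fin t → F}
    {G : (s : Fin n) → Matrix (Fin t) (Σ i : Fin m, Fin (r s i)) F}
    {T : (s : Fin n) → Matrix (Σ i : Fin m, Fin (r s i)) (Fin t) F}
    (hT : ∀ s p, T s p ∈ N.decodingSpace k a p.1) (hTG : ∀ s, T s * G s = 1)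
    (ω : SchemeSpace F k n r) (i : Fin m) (s : Fin n) (l : Fin (r s i)) :
    schemeMessage i ω s l = (T s *ᵥ relaySymbols a G ω s) ⟨i, l⟩ := by
  have hTV : T s * vandermondeMatrix k a = 0 := by
    ext p c
    have h1 := hT s p
    rw [decodingSpace_eq_supportedKernel] at h1
    have h2 := congrFun h1.1 c
    rw [Matrix.mulVec_transpose] at h2
    exact h2
  rw [relaySymbols, Matrix.mulVec_add, Matrix.mulVec_mulVec, Matrix.mulVec_mulVec, hTG, hTV,
    Matrix.one_mulVec, Matrix.zero_mulVec, add_zero]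
  rfl

variable [Fintype F]

instance : Fintype (SchemeKey F k n) := inferInstanceAs (Fintype (Fin n → Fin k → F))

instance : Nonempty (SchemeKey F k n) := inferInstanceAs (Nonempty (Fin n → Fin k → F))

instance : Fintype (SchemeSpace F k n r) :=
  inferInstanceAs (Fintype (((s : Fin n) → (i : Fin m) → Fin (r s i) → F) × SchemeKey F k n))

instance : Nonempty (SchemeSpace F k n r) :=
  inferInstanceAs (Nonempty (((s : Fin n) → (i : Fin m) → Fin (r s i) → F) × SchemeKey F k n))

instance : DiscreteMeasurableSpace (SchemeSpace F k n r) := ⟨fun _ => trivial⟩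

/-- The sample space of the scheme is the product of the message spaces and the key space. -/
def schemeSpaceEquiv (F : Type*) (k n : ℕ) (r : Fin n → Fin m → ℕ) : SchemeSpace F k n r ≃
    ((i : Fin m) → (s : Fin n) → Fin (r s i) → F) × SchemeKey F k n :=
  (Equiv.piComm fun s i => Fin (r s i) → F).prodCongr (Equiv.refl _)

instance : IsProbabilityMeasure (schemeMeasure F k n r) :=
  isProbabilityMeasure_uniformOn Set.finite_univ Set.univ_nonempty

theorem rate_schemeMessage (i : Fin m) :
    rate n F (schemeMeasure F k n r) (schemeMessage i) = (∑ s, r s i : ℕ) / (n : ℝ) := by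
  have hlog : Real.log (Fintype.card F) ≠ 0 :=
    (Real.log_pos (by exact_mod_cast Fintype.one_lt_card)).ne'
  have h : entropy (schemeMeasure F k n r) (schemeMessage i) = _ :=
    entropy_uniformOn_univ_eval (schemeSpaceEquiv F k n r) i
  rw [rate, h]
  congr 1
  simp only [Fintype.card_pi, Finset.prod_const, Finset.card_univ, Fintype.card_fin,
    Finset.prod_pow_eq_pow_sum, Nat.cast_pow, Real.log_pow]
  field_simp

/-- One-time pad: the bijection `φ` shifts the random packets by message-dependent packets `κ` that
reproduce the message part on the observed relays. The observation becomes `Y₀ ∘ φ`, with `Y₀` a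
function of the random packets alone. As `φ` fixes the messages and preserves the uniform law,
messages and observation are distributed like the independent pair `(W, Y₀)`. -/
theorem mutualInfo_schemeTransmission (N : TwoLayerNetwork t m) {a : Fin t → F}
    (ha : Function.Injective a)
    (G : (s : Fin n) → Matrix (Fin t) (Σ i : Fin m, Fin (r s i)) F) {Z : Finset N.Edge}
    (hZ : Z.card ≤ k) :
    mutualInfo (schemeMeasure F k n r) (fun ω (i : Fin m) => schemeMessage i ω)
      (fun ω (e : Z) => N.schemeTransmission a G e.1 ω) = 0 := by
  classical
  have hJ : (Z.image N.edgeRelay).card ≤ k := Finset.card_image_le.trans hZ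
  choose κ hκ using fun (w : (s : Fin n) → (i : Fin m) → Fin (r s i) → F) (s : Fin n) =>
    exists_vandermonde_mulVec_eq_on ha hJ (G s *ᵥ fun p => w s p.1 p.2)
  set φ : SchemeSpace F k n r ≃ SchemeSpace F k n r :=
    { toFun := fun ω => (ω.1, fun s => ω.2 s + κ ω.1 s)
      invFun := fun ω => (ω.1, fun s => ω.2 s - κ ω.1 s)
      left_inv := fun ω => Prod.ext rfl (funext fun s => add_sub_cancel_right _ _)
      right_inv := fun ω => Prod.ext rfl (funext fun s => sub_add_cancel _ _) } with hφ
  set W : SchemeSpace F k n r → ((i : Fin m) → (s : Fin n) → Fin (r s i) → F) :=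
    fun ω i => schemeMessage i ω
  set Y₀ : SchemeSpace F k n r → (Z → Fin n → F) :=
    fun ω e s => (vandermondeMatrix k a *ᵥ ω.2 s) (N.edgeRelay e.1)
  have hY : ∀ ω (e : Z), N.schemeTransmission a G e.1 ω = Y₀ (φ ω) e := by
    intro ω e
    funext s
    have h := hκ ω.1 s (N.edgeRelay e.1) (Finset.mem_image_of_mem _ e.2)
    rw [schemeTransmission_apply]
    change relaySymbols a G ω s (N.edgeRelay e.1) =
      (vandermondeMatrix k a *ᵥ (ω.2 s + κ ω.1 s)) (N.edgeRelay e.1)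
    rw [Matrix.mulVec_add, Pi.add_apply, h, relaySymbols, Pi.add_apply, add_comm]
  have hindep : entropy (schemeMeasure F k n r) (fun ω => (W ω, Y₀ ω)) =
      entropy (schemeMeasure F k n r) W + entropy (schemeMeasure F k n r) Y₀ := by
    refine entropy_prod_of_indep (hasMeasurableFibers_of_discrete _)
      (hasMeasurableFibers_of_discrete _) fun w y => ?_
    set g : SchemeKey F k n → (Z → Fin n → F) :=
      fun κ e s => (vandermondeMatrix k a *ᵥ κ s) (N.edgeRelay e.1)
    have h1 := uniformOn_univ_real_inter (schemeSpaceEquiv F k n r) {w} (g ⁻¹' {y})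
    rw [← uniformOn_univ_real_preimage_fst (schemeSpaceEquiv F k n r),
      ← uniformOn_univ_real_preimage_snd (schemeSpaceEquiv F k n r)] at h1
    exact h1
  simp only [mutualInfo, condEntropy, hY]
  change entropy (schemeMeasure F k n r) W - (entropy (schemeMeasure F k n r)
    (fun ω => (W ω, Y₀ (φ ω))) - entropy (schemeMeasure F k n r) (fun ω => Y₀ (φ ω))) = 0
  have h1 : entropy (schemeMeasure F k n r) (fun ω => (W ω, Y₀ (φ ω))) = _ :=
    entropy_uniformOn_comp_equiv (fun ω => (W ω, Y₀ ω)) φ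
  have h2 : entropy (schemeMeasure F k n r) (fun ω => Y₀ (φ ω)) = _ :=
    entropy_uniformOn_comp_equiv Y₀ φ
  rw [h1, h2]
  change _ - (entropy (schemeMeasure F k n r) (fun ω => (W ω, Y₀ ω)) -
    entropy (schemeMeasure F k n r) Y₀) = 0
  rw [hindep]
  ring

theorem isSecureCode_scheme (N : TwoLayerNetwork t m) {a : Fin t → F}
    (ha : Function.Injective a)
    {G : (s : Fin n) → Matrix (Fin t) (Σ i : Fin m, Fin (r s i)) F}
    {T : (s : Fin n) → Matrix (Σ i : Fin m, Fin (r s i)) (Fin t) F}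
    (hT : ∀ s p, T s p ∈ N.decodingSpace k a p.1) (hTG : ∀ s, T s * G s = 1) :
    N.IsSecureCode k n F (schemeMeasure F k n r) schemeMessage schemeKey
      (N.schemeTransmission a G) where
  isProbabilityMeasure := inferInstance
  measurable_message := fun i _ _ => trivial
  measurable_randomness := fun _ _ => trivial
  indep_messages := iIndepFun_uniformOn_univ (m := fun _ => ⊤) (schemeSpaceEquiv F k n r)
  indep_randomness := by
    let _ : MeasurableSpace ((i : Fin m) → (s : Fin n) → Fin (r s i) → F) := ⊤
    exact indepFun_uniformOn_univ (schemeSpaceEquiv F k n r)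
  source_encoding := by
    rintro (j | e) he
    · exact ⟨fun w θ s => (G s *ᵥ (fun p => w p.1 s p.2) + vandermondeMatrix k a *ᵥ θ s) j,
        fun w _ _ => trivial, fun ω => rfl⟩
    · simp [tail] at he
  relay_encoding := by
    rintro (j | e) he
    · simp [tail] at he
    · exact ⟨fun y => y ⟨Sum.inl e.2.1, rfl⟩, fun ω => rfl⟩
  decoding := by
    intro i
    rw [condEntropy, sub_eq_zero]
    refine entropy_congr_of_factorsThrough (hasMeasurableFibers_of_discrete _) ?_
      fun _ _ hab => congrArg Prod.snd hab
    intro ω ω' hω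
    refine Prod.ext ?_ hω
    funext s l
    change schemeMessage i ω s l = schemeMessage i ω' s l
    rw [schemeMessage_eq_mulVec N hT hTG, schemeMessage_eq_mulVec N hT hTG]
    simp only [Matrix.mulVec, dotProduct]
    refine Finset.sum_congr rfl fun j _ => ?_
    -- Decoding vectors vanish off `N.M i`, so the relays that destination `i` does not hear
    -- contribute nothing.
    by_cases hj : j ∈ N.M i
    · have := congrFun (congrFun hω ⟨Sum.inr ⟨i, j, hj⟩, rfl⟩) s
      change relaySymbols a G ω s j = relaySymbols a G ω' s j at this
      rw [this]
    · have h1 := hT s ⟨i, l⟩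
      rw [decodingSpace_eq_supportedKernel] at h1
      rw [h1.2 j hj, zero_mul, zero_mul]
  secrecy := fun Z hZ => N.mutualInfo_schemeTransmission ha G hZ

/-! ### Achievability of the whole polytope -/

theorem isSchemeAchievable_of_sum_le (N : TwoLayerNetwork t m)
    (hM : ∀ i j, i ≠ j → k ≤ (N.M i ∩ N.M j).card) {a : Fin t → F} (ha : Function.Injective a)
    (hn : 0 < n) (c : Fin m → ℕ)
    (hc : ∀ A : Finset (Fin m), A.Nonempty → ∑ i ∈ A, c i + n * k ≤ n * N.minCut A) :
    N.IsSchemeAchievable k F a fun i => (c i : ℝ) / n := by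
  simp only [minCut_eq_card_biUnion] at hc
  obtain ⟨r, T, hT, hind, hr⟩ := N.exists_decodingVectors hM ha c hc
  choose G hG using fun s => exists_mul_eq_one_of_linearIndependent (hind s)
  exact ⟨n, r, G, T, hn, hT, hG, N.isSecureCode_scheme ha hT hG, fun i => by
    rw [rate_schemeMessage, hr]⟩

theorem subset_schemeRegion (N : TwoLayerNetwork t m)
    (hM : ∀ i j, i ≠ j → k ≤ (N.M i ∩ N.M j).card) {a : Fin t → F} (ha : Function.Injective a) :
    {R | (∀ i, 0 ≤ R i) ∧
      ∀ A : Finset (Fin m), A.Nonempty → ∑ i ∈ A, R i ≤ (N.minCut A : ℝ) - k} ⊆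
      N.schemeRegion k F a := by
  rintro R ⟨h0, hR⟩
  -- Rounding down to `⌊R i * n⌋₊` packets keeps every upper bound on the sums, and the resulting
  -- rates tend to `R`.
  refine mem_closure_of_tendsto (b := Filter.atTop)
    (f := fun (n : ℕ) i => (⌊R i * (n : ℝ)⌋₊ : ℝ) / (n : ℝ)) ?_ ?_
  · exact tendsto_pi_nhds.2 fun i =>
      (tendsto_nat_floor_mul_div_atTop (h0 i)).comp tendsto_natCast_atTop_atTop
  · filter_upwards [Filter.eventually_gt_atTop 0] with n hn
    refine N.isSchemeAchievable_of_sum_le hM ha hn _ fun A hA => ?_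
    have h1 : ∑ i ∈ A, (⌊R i * (n : ℝ)⌋₊ : ℝ) ≤ ∑ i ∈ A, R i * (n : ℝ) :=
      Finset.sum_le_sum fun i _ => Nat.floor_le (mul_nonneg (h0 i) n.cast_nonneg)
    rw [← Finset.sum_mul] at h1
    have h2 := mul_le_mul_of_nonneg_right (hR A hA) (n.cast_nonneg (α := ℝ))
    have h3 : ((∑ i ∈ A, ⌊R i * (n : ℝ)⌋₊ + n * k : ℕ) : ℝ) ≤ (n * N.minCut A : ℕ) := by
      push_cast
      linarith
    exact_mod_cast h3

theorem schemeRegion_subset_secureCapacityRegion (N : TwoLayerNetwork t m) (k : ℕ) {F : Type}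
    [Field F] [Fintype F] (a : Fin t → F) : N.schemeRegion k F a ⊆ N.secureCapacityRegion k := by
  refine closure_mono ?_
  rintro R ⟨n, r, G, T, hn, -, -, hcode, hR⟩
  exact ⟨n, F, _, _, _, _, _, _, _, _, _, _, _, _, hn, hcode, hR⟩

end TwoLayerNetwork

end

theorem lemma3 {t m : ℕ} (N : TwoLayerNetwork t m) (k : ℕ)
    (hk : ∀ i, k ≤ (N.M i).card)
    (hM : ∀ i j, i ≠ j → k ≤ (N.M i ∩ N.M j).card) :
    N.secureCapacityRegion k =
      {R | (∀ i, 0 ≤ R i) ∧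
        ∀ A : Finset (Fin m), A.Nonempty → ∑ i ∈ A, R i ≤ (N.minCut A : ℝ) - k} ∧
    ∀ (F : Type) [Field F] [Fintype F] (a : Fin t → F), Function.Injective a →
      N.schemeRegion k F a = N.secureCapacityRegion k := by
  have houter := N.secureCapacityRegion_subset hk
  refine ⟨houter.antisymm ?_, fun F _ _ a ha =>
    (N.schemeRegion_subset_secureCapacityRegion k a).antisymm
      (houter.trans (N.subset_schemeRegion hM ha))⟩
  -- The capacity region allows any field, so one with `t` distinct evaluation points suffices:
  -- `ZMod p` with `p ≥ t`.
  obtain ⟨p, hp, hprime⟩ := Nat.exists_infinite_primes t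
  have : Fact p.Prime := ⟨hprime⟩
  have ha : Function.Injective fun j : Fin t => ((j : ℕ) : ZMod p) := by
    intro i j hij
    have h := congrArg ZMod.val hij
    simp only [ZMod.val_natCast_of_lt (i.2.trans_le hp),
      ZMod.val_natCast_of_lt (j.2.trans_le hp)] at h
    exact Fin.ext h
  exact (N.subset_schemeRegion hM ha).trans (N.schemeRegion_subset_secureCapacityRegion k _)
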